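/- **Systems.** An assemble-to-order (ATO) system has $m$ products, $n$ components and $K\ge 1$ distinct deterministic lead times $0=L_0<L_1<\dots<L_K$; component $j$ has lead time $L_{k_j}$, and each $k\in\{1,\dots,K\}$ is some $k_j$. One unit of product $i$ uses $a_{ji}\in\mathbb Z_{\ge 0}$ units of component $j$; $A=(a_{ji})$ has no zero row or column, $\mathbf A_j$ is its $j$-th row and $A^k$ consists of the rows with $k_j=k$ (for an $n$-vector, the superscript $k$ likewise denotes the block of coordinates with $k_j=k$). Holding costs $h_j$ and backlog costs $b_i$ are strictly positive, and $\mathbf c=\mathbf b+A'\mathbf h$. Cumulative demand $\mathcal D(t)$, $t\ge -L_K$, is a $\mathbb Z_{\ge0}^m$-valued compound Poisson process started at $0$ at time $-L_K$, with order arrival rate $\underline\lambda$ and order size vector $\mathbf S$, $\mathbf E[S_i^6]<\infty$ and $\mu_i=\underline\lambda\,\mathbf E[S_i]>0$ for all $i$. Put $\mathbf D(t_1,t_2)=\mathcal D(t_2)-\mathcal D(t_1)$, let $\mathbf D^k$ be distributed as $\mathbf D(t-L_k,t-L_{k-1})$ and $\bar{\mathbf D}$ as $\mathbf D(t-L_K,t)$,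 for any $t\ge 0$. A (feasible, non-anticipating) policy consists of non-decreasing, right-continuous, non-negative integer-valued processes: $\mathcal R_j(t)$, the amount of component $j$ ordered during $[-L_{k_j},t]$ (zero for $t<-L_{k_j}$), and $\mathcal Z_i(t)$, the demand for product $i$ served up to $t$ (zero for $t<0$). Both are adapted to the filtration generated by the demand process. On-hand inventory is $I_j(t)=\mathcal R_j(t-L_{k_j})-\mathbf A_j\cdot\mathcal Z(t)$ and backlog is $\mathbf B(t)=\mathcal D(t)-\mathcal Z(t)$; both must be non-negative. The inventory position is $IP_j(t)=I_j(t)+\mathcal R_j(t)-\mathcal R_j(t-L_{k_j})-\mathbf A_j\cdot\mathbf B(t)$. The expected cost rate is $\mathcal C(t)=\sum_j h_j\mathbf E[I_j(t)]+\sum_i b_i\mathbf E[B_i(t)]$, the long-run average cost is $\mathcal C=\limsup_{T\to\infty}\frac1T\int_0^T\mathcal C(t)\,dt\in[0,\infty]$, and $\mathcal C_{\min}$ is the infimum of $\mathcal C$ over all policies. **Stochastic programs.** Let $\underline C=\inf_{\boldsymbol\alpha\ge 0}\{\mathbf b\cdot\boldsymbol\alpha+\Phi^K(\boldsymbol\alpha)\}+\mathbf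 b\cdot\mathbf E[\bar{\mathbf D}]$, where for $k=K,\dots,1$ $$\Phi^k(\mathbf y^{k+1},\dots,\mathbf y^K,\mathbf x)=\inf_{\mathbf y^k\ge 0}\{\mathbf h^k\cdot\mathbf y^k+\mathbf E[\Phi^{k-1}(\mathbf y^k,\dots,\mathbf y^K,\mathbf x+\mathbf D^k)]\},$$ $$\Phi^0(\mathbf y^1,\dots,\mathbf y^K,\mathbf x)=-\max\{\mathbf c\cdot\mathbf z\mid \mathbf z\ge 0,\ \mathbf z\le\mathbf x,\ A^k\mathbf z\le\mathbf y^k\ (1\le k\le K)\}.$$ Let $\varphi^k$ be defined by the same recursion without the constraints $\mathbf y^k\ge0$ and $\mathbf z\ge 0$. **Targets.** For $t\ge -L_k$ let $\mathbb Y^k(t)$ be an optimal solution of $\varphi^k(\mathbf y^{k+1},\dots,\mathbf y^K,\mathbf x)$ with $\mathbf y^l=\mathbb Y^l(t-(L_l-L_k))$ $(k<l\le K)$ and $\mathbf x=\mathbf D(t-(L_K-L_k),t)$, determined by the demand up to time $t$. The target inventory positions are $\mathbb{IP}^k(t)=\mathbb Y^k(t)-A^k\mathbf D(t-(L_K-L_k),t)$.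 For $t\ge 0$, the ideal backlog target $\mathbb B^*(t)$ is an optimal solution of $\min\{\mathbf c\cdot\mathbf B\mid\mathbf B\ge0,\ A^k\mathbf B\ge\mathbb Q^k(t)\ (1\le k\le K)\}$ with $\mathbb Q^k(t)=A^k\mathbf D(t-L_k,t)-\mathbb{IP}^k(t-L_k)$. **Theorem 3 (Master Theorem).** Consider a family of ATO systems indexed by their longest lead time $L=L_K^{(L)}>0$. The quantities $A$, $(k_j)$, $\mathbf h$, $\mathbf b$, $\underline\lambda$ and the law of $\mathbf S$ are the same for all $L$, while the lead times $L^{(L)}_k$ $(k<K)$ may depend on $L$ in any way. Each system is controlled by a policy; a superscript $(L)$ refers to the $L$-th system. Put $\hat L_k^{(L)}=L_k^{(L)}/L$, and let a hat on $IP$, $\mathbb{IP}$, $B$, $\mathbb B^*$ denote the scaling $\hat f(t)=f(Lt)/\sqrt L$; also $\hat{\mathcal C}^{(L)}=\mathcal C^{(L)}/\sqrt L$ and $\hat{\underline C}^{(L)}=\underline C^{(L)}/\sqrt L$. If $$\lim_{L\to\infty}\mathbf E\Big[\sup_{t\ge-\hat L^{(L)}_{k_j}}\big|\widehat{IP}^{(L)}_j(t)-\widehat{\mathbb{IP}}^{(L)}_j(t)\big|\Big]=0,\quad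 1\le j\le n,$$ and $$\lim_{L\to\infty}\mathbf E\Big[\sup_{t\ge0}\big|\hat B^{(L)}_i(t)-\hat{\mathbb B}^{*(L)}_i(t)\big|\Big]=0,\quad 1\le i\le m,$$ then $\mathcal C^{(L)}<\infty$ and $0<\mathcal C^{(L)}_{\min}<\infty$ for all sufficiently large $L$, $$\lim_{L\to\infty}\big\{\hat{\mathcal C}^{(L)}-\hat{\underline C}^{(L)}\big\}=0,\qquad\text{and}\qquad\lim_{L\to\infty}\frac{\mathcal C^{(L)}-\mathcal C^{(L)}_{\min}}{\mathcal C^{(L)}_{\min}}=0.$$ -/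

import Mathlib

open MeasureTheory ProbabilityTheory Filter Topology
open scoped NNReal ENNReal

namespace ATO

noncomputable section

/-- The data of an assemble-to-order (ATO) system that do not vary with the lead times:
`m` products, `n` components, the number `K` of distinct lead times, the bill of materials `A`
(`A j i` units of component `j` go into one unit of product `i`), the index `grp j ∈ {1, …, K}` of
the lead time of component `j`, holding costs `h` and backlog costs `b`. -/
structure Spec (m n : ℕ) where
  K : ℕ
  A : Matrix (Fin n) (Fin m) ℕ
  grp : Fin n → ℕ
  h : Fin n → ℝ
  b : Fin m → ℝ
  grp_mem : ∀ j, 1 ≤ grp j ∧ grp j ≤ K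
  grp_surj : ∀ k, 1 ≤ k → k ≤ K → ∃ j, grp j = k
  row_ne_zero : ∀ j, ∃ i, A j i ≠ 0
  col_ne_zero : ∀ i, ∃ j, A j i ≠ 0
  h_pos : ∀ j, 0 < h j
  b_pos : ∀ i, 0 < b i

variable {m n : ℕ} {Ω : Type*} [MeasurableSpace Ω]

/-- `A_j · x`, the amount of component `j` needed for the product quantities `x`. -/
def Spec.usage (S : Spec m n) (j : Fin n) (x : Fin m → ℝ) : ℝ := ∑ i, (S.A j i : ℝ) * x i

/-- `c = b + ∑ₖ (Aᵏ)' hᵏ`. -/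
def Spec.c (S : Spec m n) (i : Fin m) : ℝ := S.b i + ∑ j, (S.A j i : ℝ) * S.h j

/-- `ℓ 1 < ⋯ < ℓ K` are positive lead times, the longest of which is `L`; by convention `ℓ 0 = 0`. -/
structure IsLeadTimes (K : ℕ) (ℓ : ℕ → ℝ) (L : ℝ) : Prop where
  zero : ℓ 0 = 0
  strictMono : StrictMonoOn ℓ (Set.Iic K)
  longest : ℓ K = L

/-- `N` is a Poisson process with rate `lam` started (at zero) at time `t₀`, with
nondecreasing right-continuous paths. -/
structure IsPoissonProcess (P : Measure Ω) (t₀ : ℝ) (lam : ℝ≥0) (N : ℝ → Ω → ℕ) : Prop where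
  measurable : ∀ t, Measurable (N t)
  eq_zero : ∀ t ≤ t₀, ∀ ω, N t ω = 0
  mono : ∀ ω, Monotone fun t => N t ω
  rightCont : ∀ ω t, ContinuousWithinAt (fun s => N s ω) (Set.Ici t) t
  indep : HasIndepIncrements N P
  law : ∀ s t, t₀ ≤ s → s ≤ t →
    P.map (fun ω => N t ω - N s ω) = poissonMeasure (lam * (t - s).toNNReal)

/-- `D` is a compound Poisson demand process started at time `t₀`, with order arrival rate `lam`
and order size law `ν`: `D t ω i` is the cumulative demand for product `i` during `[t₀, t]`. -/
def IsCompoundPoisson (P : Measure Ω) (t₀ : ℝ) (lam : ℝ≥0) (ν : Measure (Fin m → ℕ))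
    (D : ℝ → Ω → Fin m → ℕ) : Prop :=
  ∃ (N : ℝ → Ω → ℕ) (X : ℕ → Ω → Fin m → ℕ),
    IsPoissonProcess P t₀ lam N ∧
    (∀ r, Measurable (X r)) ∧ (∀ r, P.map (X r) = ν) ∧ iIndepFun X P ∧
    IndepFun (fun ω t => N t ω) (fun ω r => X r ω) P ∧
    ∀ t ω i, D t ω i = ∑ r ∈ Finset.range (N t ω), X r ω i

/-- `D(t₁, t₂)`, the demand that arrives between `t₁` and `t₂`. -/
def demand (D : ℝ → Ω → Fin m → ℕ) (t₁ t₂ : ℝ) (ω : Ω) (i : Fin m) : ℝ :=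
  (D t₂ ω i : ℝ) - (D t₁ ω i : ℝ)

/-- The information available at time `t`: the σ-algebra generated by the demand up to time `t`.
(The initial state of the system is deterministic.) -/
@[reducible] def history (D : ℝ → Ω → Fin m → ℕ) (t : ℝ) : MeasurableSpace Ω :=
  ⨆ s ∈ Set.Iic t, MeasurableSpace.comap (D s) inferInstance

/-! ### The controlled system

`R t ω j` is the amount of component `j` ordered during `[-ℓ (grp j), t]`, and `Z t ω i` the amount
of demand for product `i` served up to time `t`. -/

/-- On-hand inventory `I_j(t)`: everything ordered up to one lead time ago, minus all usage. -/
def onHand (S : Spec m n) (ℓ : ℕ → ℝ) (R : ℝ → Ω → Fin n → ℕ) (Z : ℝ → Ω → Fin m → ℕ)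
    (t : ℝ) (ω : Ω) (j : Fin n) : ℝ :=
  (R (t - ℓ (S.grp j)) ω j : ℝ) - S.usage j fun i => (Z t ω i : ℝ)

/-- Amount of component `j` in transit at time `t`. -/
def inTransit (S : Spec m n) (ℓ : ℕ → ℝ) (R : ℝ → Ω → Fin n → ℕ)
    (t : ℝ) (ω : Ω) (j : Fin n) : ℝ :=
  (R t ω j : ℝ) - (R (t - ℓ (S.grp j)) ω j : ℝ)

/-- Backlog `B_i(t)`. -/
def backlog (D Z : ℝ → Ω → Fin m → ℕ) (t : ℝ) (ω : Ω) (i : Fin m) : ℝ :=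
  (D t ω i : ℝ) - (Z t ω i : ℝ)

/-- Inventory position `IP_j(t) = I_j(t) + R_j(t) - A_j · B(t)`. -/
def invPos (S : Spec m n) (ℓ : ℕ → ℝ) (D : ℝ → Ω → Fin m → ℕ)
    (R : ℝ → Ω → Fin n → ℕ) (Z : ℝ → Ω → Fin m → ℕ) (t : ℝ) (ω : Ω) (j : Fin n) : ℝ :=
  onHand S ℓ R Z t ω j + inTransit S ℓ R t ω j - S.usage j (backlog D Z t ω)

/-- Feasible non-anticipating policies. Ordering of component `j` starts at `-ℓ (grp j)`, service
starts at time `0`; neither on-hand inventory nor backlog is ever negative. -/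
structure IsPolicy (S : Spec m n) (ℓ : ℕ → ℝ) (D : ℝ → Ω → Fin m → ℕ)
    (R : ℝ → Ω → Fin n → ℕ) (Z : ℝ → Ω → Fin m → ℕ) : Prop where
  adapted_R : ∀ t, Measurable[history D t] (R t)
  adapted_Z : ∀ t, Measurable[history D t] (Z t)
  mono_R : ∀ ω, Monotone fun t => R t ω
  mono_Z : ∀ ω, Monotone fun t => Z t ω
  rightCont_R : ∀ ω t, ContinuousWithinAt (fun s => R s ω) (Set.Ici t) t
  rightCont_Z : ∀ ω t, ContinuousWithinAt (fun s => Z s ω) (Set.Ici t) t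
  start_R : ∀ ω j, ∀ t < -ℓ (S.grp j), R t ω j = 0
  start_Z : ∀ ω, ∀ t < 0, Z t ω = 0
  onHand_nonneg : ∀ ω j, ∀ t ≥ 0, 0 ≤ onHand S ℓ R Z t ω j
  backlog_nonneg : ∀ ω i, ∀ t ≥ 0, 0 ≤ backlog D Z t ω i

/-- Expected inventory cost rate at time `t`, as an extended nonnegative real. -/
def costRate (S : Spec m n) (ℓ : ℕ → ℝ) (P : Measure Ω) (D : ℝ → Ω → Fin m → ℕ)
    (R : ℝ → Ω → Fin n → ℕ) (Z : ℝ → Ω → Fin m → ℕ) (t : ℝ) : ℝ≥0∞ :=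
  (∑ j, ENNReal.ofReal (S.h j) * ∫⁻ ω, ENNReal.ofReal (onHand S ℓ R Z t ω j) ∂P) +
    ∑ i, ENNReal.ofReal (S.b i) * ∫⁻ ω, ENNReal.ofReal (backlog D Z t ω i) ∂P

/-- Long-run average expected cost. -/
def avgCost (S : Spec m n) (ℓ : ℕ → ℝ) (P : Measure Ω) (D : ℝ → Ω → Fin m → ℕ)
    (R : ℝ → Ω → Fin n → ℕ) (Z : ℝ → Ω → Fin m → ℕ) : ℝ≥0∞ :=
  limsup (fun T : ℝ => (ENNReal.ofReal T)⁻¹ * ∫⁻ t in Set.Ioc 0 T, costRate S ℓ P D R Z t) atTop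

/-- The optimal long-run average cost over all feasible non-anticipating policies. -/
def minCost (S : Spec m n) (ℓ : ℕ → ℝ) (P : Measure Ω) (D : ℝ → Ω → Fin m → ℕ) : ℝ≥0∞ :=
  ⨅ (R : ℝ → Ω → Fin n → ℕ) (Z : ℝ → Ω → Fin m → ℕ) (_ : IsPolicy S ℓ D R Z),
    avgCost S ℓ P D R Z

/-! ### The stochastic programs

A stage-`k` value function takes the decisions already made, `y^{k+1}, …, y^K`, and the cumulative
demand `x`. The former are stored in one vector `y : Fin n → ℝ`, of which only the coordinates `j`
with `grp j > k` matter. The stage-`k` demand vector `Dᵏ`, `1 ≤ k ≤ K`, is realized as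
`D(-ℓ k, -ℓ (k - 1))`. -/

/-- Quantities of the components with the `k`-th lead time. -/
abbrev Spec.Block (S : Spec m n) (k : ℕ) : Type := {j : Fin n // S.grp j = k} → ℝ

/-- `y` with its `k`-th block replaced by `v`. -/
def Spec.setBlock (S : Spec m n) (k : ℕ) (y : Fin n → ℝ) (v : S.Block k) (j : Fin n) : ℝ :=
  if hj : S.grp j = k then v ⟨j, hj⟩ else y j

/-- `hᵏ · v + E[φ(v, y^{k+1}, …, y^K, x + Dᵏ)]`, the stage-`k` objective, given the value function
`φ` of stage `k - 1`. -/
def stageObj (S : Spec m n) (ℓ : ℕ → ℝ) (P : Measure Ω) (D : ℝ → Ω → Fin m → ℕ)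
    (φ : (Fin n → ℝ) → (Fin m → ℝ) → ℝ) (k : ℕ) (y : Fin n → ℝ) (x : Fin m → ℝ)
    (v : S.Block k) : ℝ :=
  ∑ j : {j : Fin n // S.grp j = k}, S.h j * v j +
    ∫ ω, φ (S.setBlock k y v) (x + demand D (-ℓ k) (-ℓ (k - 1)) ω) ∂P

/-- The value functions `Φᵏ` of the stochastic program with nonnegativity constraints. -/
def valueNonneg (S : Spec m n) (ℓ : ℕ → ℝ) (P : Measure Ω) (D : ℝ → Ω → Fin m → ℕ) :
    ℕ → (Fin n → ℝ) → (Fin m → ℝ) → ℝ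
  | 0, y, x => -sSup ((fun z : Fin m → ℝ => ∑ i, S.c i * z i) ''
      {z | 0 ≤ z ∧ z ≤ x ∧ ∀ j, S.usage j z ≤ y j})
  | k + 1, y, x => sInf (stageObj S ℓ P D (valueNonneg S ℓ P D k) (k + 1) y x '' {v | 0 ≤ v})

/-- The lower bound `inf_{α ≥ 0} {b · α + Φᴷ(α)} + b · E[D(-ℓ K, 0)]` on the average cost. -/
def lowerBound (S : Spec m n) (ℓ : ℕ → ℝ) (P : Measure Ω) (D : ℝ → Ω → Fin m → ℕ) : ℝ :=
  sInf ((fun α : Fin m → ℝ => ∑ i, S.b i * α i + valueNonneg S ℓ P D S.K 0 α) '' {α | 0 ≤ α}) +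
    ∑ i, S.b i * ∫ ω, demand D (-ℓ S.K) 0 ω i ∂P

/-- The value functions `φᵏ` of the stochastic program without nonnegativity constraints. -/
def value (S : Spec m n) (ℓ : ℕ → ℝ) (P : Measure Ω) (D : ℝ → Ω → Fin m → ℕ) :
    ℕ → (Fin n → ℝ) → (Fin m → ℝ) → ℝ
  | 0, y, x => -sSup ((fun z : Fin m → ℝ => ∑ i, S.c i * z i) ''
      {z | z ≤ x ∧ ∀ j, S.usage j z ≤ y j})
  | k + 1, y, x => sInf (Set.range (stageObj S ℓ P D (value S ℓ P D k) (k + 1) y x))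

/-- `v` is an optimal solution of `φᵏ(y^{k+1}, …, y^K, x)`, for `k ≥ 1`. -/
def IsStageOptimal (S : Spec m n) (ℓ : ℕ → ℝ) (P : Measure Ω) (D : ℝ → Ω → Fin m → ℕ)
    (k : ℕ) (y : Fin n → ℝ) (x : Fin m → ℝ) (v : S.Block k) : Prop :=
  ∀ v', stageObj S ℓ P D (value S ℓ P D (k - 1)) k y x v ≤
    stageObj S ℓ P D (value S ℓ P D (k - 1)) k y x v'

/-- The processes `𝕐ᵏ(t)`, `t ≥ -ℓ k` (`Y t ω j` is the coordinate of component `j`): `𝕐ᵏ(t)` is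
determined by the demand up to time `t` and is an optimal solution of `φᵏ(y^{k+1}, …, y^K, x)` for
`y^l = 𝕐^l(t - (ℓ l - ℓ k))` and `x = D(t - (ℓ K - ℓ k), t)`. -/
structure IsSPSolution (S : Spec m n) (ℓ : ℕ → ℝ) (P : Measure Ω) (D : ℝ → Ω → Fin m → ℕ)
    (Y : ℝ → Ω → Fin n → ℝ) : Prop where
  adapted : ∀ j, ∀ t ≥ -ℓ (S.grp j), Measurable[history D t] fun ω => Y t ω j
  optimal : ∀ k, 1 ≤ k → k ≤ S.K → ∀ t ≥ -ℓ k, ∀ᵐ ω ∂P,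
    IsStageOptimal S ℓ P D k (fun j => Y (t - (ℓ (S.grp j) - ℓ k)) ω j)
      (demand D (t - (ℓ S.K - ℓ k)) t ω) (fun j => Y t ω j)

/-- The target inventory position of component `j`. -/
def targetPos (S : Spec m n) (ℓ : ℕ → ℝ) (D : ℝ → Ω → Fin m → ℕ) (Y : ℝ → Ω → Fin n → ℝ)
    (t : ℝ) (ω : Ω) (j : Fin n) : ℝ :=
  Y t ω j - S.usage j (demand D (t - (ℓ S.K - ℓ (S.grp j))) t ω)

/-- The ideal component balance `ℚ_j(t)`, attained when inventory positions are on target. -/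
def idealBalance (S : Spec m n) (ℓ : ℕ → ℝ) (D : ℝ → Ω → Fin m → ℕ) (Y : ℝ → Ω → Fin n → ℝ)
    (t : ℝ) (ω : Ω) (j : Fin n) : ℝ :=
  S.usage j (demand D (t - ℓ (S.grp j)) t ω) - targetPos S ℓ D Y (t - ℓ (S.grp j)) ω j

/-- `β` is an optimal solution of `min {c · β | β ≥ 0, A β ≥ q}`. -/
def IsBacklogOptimal (S : Spec m n) (q : Fin n → ℝ) (β : Fin m → ℝ) : Prop :=
  IsMinOn (fun β : Fin m → ℝ => ∑ i, S.c i * β i) {β | 0 ≤ β ∧ ∀ j, q j ≤ S.usage j β} β ∧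
    0 ≤ β ∧ ∀ j, q j ≤ S.usage j β

/-- The ideal backlog targets `𝔹*(t)`, `t ≥ 0`. -/
structure IsIdealBacklog (S : Spec m n) (ℓ : ℕ → ℝ) (P : Measure Ω) (D : ℝ → Ω → Fin m → ℕ)
    (Y : ℝ → Ω → Fin n → ℝ) (Bs : ℝ → Ω → Fin m → ℝ) : Prop where
  measurable : ∀ t ≥ 0, Measurable (Bs t)
  optimal : ∀ t ≥ 0, ∀ᵐ ω ∂P, IsBacklogOptimal S (idealBalance S ℓ D Y t ω) (Bs t ω)

/-- Diffusion scaling `f(L t) / √L`. -/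
def scaled {ι : Type*} (L : ℝ) (f : ℝ → Ω → ι → ℝ) (t : ℝ) (ω : Ω) (i : ι) : ℝ :=
  f (L * t) ω i / √L

/-- `E[sup_{t ≥ t₀} |f_i(t) - g_i(t)|]`, as an extended nonnegative real. -/
def expSupDist {ι : Type*} (P : Measure Ω) (t₀ : ℝ) (f g : ℝ → Ω → ι → ℝ) (i : ι) : ℝ≥0∞ :=
  ∫⁻ ω, ⨆ t ∈ Set.Ici t₀, ENNReal.ofReal |f t ω i - g t ω i| ∂P

end

end ATO

/-!
The theorem follows from three facts about a single system.

*No policy beats the lower bound, at any time.* Let `q j` be the demand for component `j` over its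
lead time less its inventory position one lead time ago. With backlog `β`, on-hand inventory is
`A β - q`, so that the cost rate is `c · β - h · q`, and this is at least `S.lpCost q`, its
infimum over all `β ≥ 0` with `A β ≥ q`. The inventory position of a component with lead
time `ℓ k` has to be chosen at time `t - ℓ k`. Up to a normalization (`value_eq`), `φᵏ` is the
function `costToGo`, which is nonnegative and Lipschitz continuous, so that no integral has a junk
value. Demand after time `t - ℓ k` is independent of the history
(`IsCompoundPoisson.measure_inter_inc`), whence decisions that use the history are, stage by stage,
no better than the relaxed program (`lowerBound_le_lintegral_lpCost`). The targets are optimal at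
every stage and attain its value exactly (`lintegral_lpCost_eq_lowerBound`).

*The nonnegativity constraints cost nothing.* The relaxed program is invariant if product quantities
are traded for the components that they need (`costToGo_shift`). Large `α` therefore moves its
near-optimal decisions into the nonnegative orthant, and dominated convergence shows that the value
of the constrained program tends to that of the relaxed one (`tendsto_costToGoNonneg`). Hence
`lowerBound` is the value of the relaxed program (`lowerBound_eq`).

*The lower bound is at least of the order `√L`.* The decision for a component with the longest lead
time precedes all of the demand over that lead time, and a deviation of the balance of this component
from `0` in either direction is costly. The mean absolute deviation of compound Poisson demand from
any point is of the order `√L` (`cpLaw_dispersion`).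

Since the cost rate is linear in backlogs and balances, it exceeds the lower bound by at most the
weighted expected distances to the targets (`IsPolicy.costRate_le`), which are `o(√L)` by assumption.
Together with the first fact this determines the average cost and the minimum cost up to `o(√L)`, and
by the third fact this error is negligible relative to the minimum cost.
-/

namespace ATO

noncomputable section

/-! ### Independence of past and future for compound Poisson demand -/

/-- If a pair of σ-algebras is independent of another pair, and each pair consists of independent
σ-algebras, then the σ-algebras can be regrouped. -/
lemma indep_sup_sup {Ω : Type*} {mΩ : MeasurableSpace Ω} {P : Measure Ω} [IsProbabilityMeasure P]
    {a₁ a₂ x₁ x₂ : MeasurableSpace Ω} (ha₁ : a₁ ≤ mΩ) (ha₂ : a₂ ≤ mΩ) (hx₁ : x₁ ≤ mΩ) (hx₂ : x₂ ≤ mΩ)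
    (ha : Indep a₁ a₂ P) (hx : Indep x₁ x₂ P) (hax : Indep (a₁ ⊔ a₂) (x₁ ⊔ x₂) P) :
    Indep (a₁ ⊔ x₁) (a₂ ⊔ x₂) P := by
  have gen : ∀ a x : MeasurableSpace Ω, a ⊔ x = MeasurableSpace.generateFrom
      {s | ∃ u v, MeasurableSet[a] u ∧ MeasurableSet[x] v ∧ s = u ∩ v} := by
    intro a x
    apply le_antisymm
    · refine sup_le (fun u hu => ?_) (fun v hv => ?_)
      · exact MeasurableSpace.measurableSet_generateFrom
          ⟨u, Set.univ, hu, MeasurableSet.univ, (Set.inter_univ u).symm⟩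
      · exact MeasurableSpace.measurableSet_generateFrom
          ⟨Set.univ, v, MeasurableSet.univ, hv, (Set.univ_inter v).symm⟩
    · refine MeasurableSpace.generateFrom_le ?_
      rintro _ ⟨u, v, hu, hv, rfl⟩
      exact MeasurableSet.inter (le_sup_left (a := a) (b := x) u hu)
        (le_sup_right (a := a) (b := x) v hv)
  have pi : ∀ a x : MeasurableSpace Ω, IsPiSystem
      {s | ∃ u v, MeasurableSet[a] u ∧ MeasurableSet[x] v ∧ s = u ∩ v} := by
    rintro a x _ ⟨u, v, hu, hv, rfl⟩ _ ⟨u', v', hu', hv', rfl⟩ -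
    exact ⟨u ∩ u', v ∩ v', hu.inter hu', hv.inter hv', Set.inter_inter_inter_comm ..⟩
  refine IndepSets.indep (sup_le ha₁ hx₁) (sup_le ha₂ hx₂) (pi a₁ x₁) (pi a₂ x₂) (gen a₁ x₁)
    (gen a₂ x₂) ?_
  rw [IndepSets_iff]
  rintro _ _ ⟨u, v, hu, hv, rfl⟩ ⟨u', v', hu', hv', rfl⟩
  have L₁ : ∀ {u}, MeasurableSet[a₁] u → MeasurableSet[a₁ ⊔ a₂] u :=
    fun {u} h => le_sup_left (a := a₁) (b := a₂) u h
  have L₂ : ∀ {u}, MeasurableSet[a₂] u → MeasurableSet[a₁ ⊔ a₂] u :=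
    fun {u} h => le_sup_right (a := a₁) (b := a₂) u h
  have M₁ : ∀ {u}, MeasurableSet[x₁] u → MeasurableSet[x₁ ⊔ x₂] u :=
    fun {u} h => le_sup_left (a := x₁) (b := x₂) u h
  have M₂ : ∀ {u}, MeasurableSet[x₂] u → MeasurableSet[x₁ ⊔ x₂] u :=
    fun {u} h => le_sup_right (a := x₁) (b := x₂) u h
  rw [Indep_iff] at ha hx hax
  rw [Set.inter_inter_inter_comm, hax _ _ ((L₁ hu).inter (L₂ hu')) ((M₁ hv).inter (M₂ hv')),
    hax _ _ (L₁ hu) (M₁ hv), hax _ _ (L₂ hu') (M₂ hv'), ha _ _ hu hu', hx _ _ hv hv']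
  ring

/-- Finitely many times above `c` can be listed by a nondecreasing sequence that starts at `c`. -/
lemma exists_monotone_enumeration (c : ℝ) (F : Finset ℝ) (hF : ∀ u ∈ F, c ≤ u) :
    ∃ (τ : ℕ → ℝ) (p : ℕ), Monotone τ ∧ τ 0 = c ∧ (∀ u ∈ F, ∃ i ≤ p, τ i = u) ∧
      ∀ i, τ i = c ∨ τ i ∈ F := by
  induction F using Finset.induction_on_max with
  | empty => exact ⟨fun _ => c, 0, fun _ _ _ => le_rfl, rfl, by simp, by simp⟩
  | insert a F ha ih =>
    obtain ⟨τ, p, hmono, h0, hex, hmem⟩ := ih fun u hu => hF u (Finset.mem_insert_of_mem hu)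
    have hle : ∀ i, τ i ≤ a := fun i => by
      rcases hmem i with h | h
      · rw [h]; exact hF a (Finset.mem_insert_self a F)
      · exact (ha _ h).le
    refine ⟨fun i => if i ≤ p then τ i else a, p + 1, ?_, by simp [h0], ?_, ?_⟩
    · intro i j hij
      by_cases hj : j ≤ p
      · simp only [hij.trans hj, hj, if_true]; exact hmono hij
      · simp only [hj, if_false]
        split_ifs
        · exact hle i
        · exact le_rfl
    · intro u hu
      rcases Finset.mem_insert.1 hu with rfl | hu
      · exact ⟨p + 1, le_rfl, by simp⟩
      · obtain ⟨i, hi, rfl⟩ := hex u hu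
        exact ⟨i, by omega, by simp [hi]⟩
    · intro i
      by_cases hi : i ≤ p
      · simp only [hi, if_true]
        exact (hmem i).imp_right Finset.mem_insert_of_mem
      · simp [hi]

/-- The σ-algebra generated by the arrival counts up to time `s`. -/
@[reducible] def arrivalHistory {Ω : Type*} (N : ℝ → Ω → ℕ) (s : ℝ) : MeasurableSpace Ω :=
  ⨆ u : Set.Iic s, MeasurableSpace.comap (N u) inferInstance

/-- The σ-algebra generated by the orders with index in `T`. -/
@[reducible] def orderSigma {Ω E : Type*} [MeasurableSpace E] (X : ℕ → Ω → E) (T : Set ℕ) :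
    MeasurableSpace Ω :=
  ⨆ r ∈ T, MeasurableSpace.comap (X r) inferInstance

section

variable {Ω : Type*} [MeasurableSpace Ω] {P : Measure Ω} {t₀ : ℝ} {lam : ℝ≥0} {N : ℝ → Ω → ℕ}

/-- For a Poisson process, the past up to time `s` is independent of a later increment. -/
lemma IsPoissonProcess.indep_past [IsProbabilityMeasure P] (hN : IsPoissonProcess P t₀ lam N)
    {s t : ℝ} (hst : s ≤ t) :
    Indep (arrivalHistory N s)
      (MeasurableSpace.comap (fun ω => N t ω - N s ω) inferInstance) P := by
  have hle : ∀ u, MeasurableSpace.comap (N u) inferInstance ≤ (inferInstance : MeasurableSpace Ω) :=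
    fun u => (hN.measurable u).comap_le
  have hle' : MeasurableSpace.comap (fun ω => N t ω - N s ω) inferInstance ≤
      (inferInstance : MeasurableSpace Ω) := ((hN.measurable t).sub (hN.measurable s)).comap_le
  rw [arrivalHistory, iSup_eq_iSup_finset]
  refine indep_iSup_of_directed_le (fun F => ?_)
    (fun F => iSup₂_le fun u _ => hle u) hle' (Monotone.directed_le ?_)
  swap
  · exact fun F G hFG => biSup_mono fun u hu => hFG hu
  classical
  -- a common lower bound of all the times involved, at which the process has not yet started
  obtain ⟨c, hc⟩ : ∃ c : ℝ, ∀ u ∈ insert s (insert t₀ (F.image Subtype.val)), c ≤ u :=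
    (Finset.bddBelow _)
  obtain ⟨τ, p, hmono, h0, hex, hmem⟩ := exists_monotone_enumeration c (F.image Subtype.val)
    fun u hu => hc u (by simp only [Finset.mem_insert]; exact Or.inr (Or.inr hu))
  have hτs : ∀ i, τ i ≤ s := fun i => by
    rcases hmem i with h | h
    · rw [h]; exact hc s (by simp)
    · obtain ⟨u, -, hu⟩ := Finset.mem_image.1 h
      rw [← hu]; exact u.2
  let σ : ℕ → ℝ := fun i => if i ≤ p then τ i else if i = p + 1 then s else t
  have hσ : Monotone σ := by
    intro i j hij
    simp only [σ]
    split_ifs <;> first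
      | exact hmono hij
      | exact hτs _
      | exact (hτs _).trans hst
      | exact le_rfl
      | exact hst
      | omega
  have hind := hN.indep.nat hσ
  rw [iIndepFun_iff_iIndep] at hind
  have key := indep_iSup_of_disjoint (S := Set.Iio (p + 1)) (T := {p + 1})
    (fun i => ((hN.measurable (σ (i + 1))).sub (hN.measurable (σ i))).comap_le) hind
    (by simp)
  refine indep_of_indep_of_le key (iSup₂_le fun u hu => ?_) ?_
  · obtain ⟨i, hi, hiu⟩ := hex u (Finset.mem_image_of_mem _ hu)
    have hrep : ∀ j ≤ p, ∀ ω, N (τ j) ω =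
        ∑ l ∈ Finset.range j, (N (σ (l + 1)) ω - N (σ l) ω) := by
      intro j hj ω
      rw [Finset.sum_range_tsub (f := fun l => N (σ l) ω) fun a b hab => hN.mono ω (hσ hab)]
      have : N (σ 0) ω = 0 := hN.eq_zero _ (by
        simp only [σ, Nat.zero_le, if_true, h0]; exact hc t₀ (by simp)) ω
      rw [this, tsub_zero]
      simp [σ, hj]
    rw [← measurable_iff_comap_le, ← hiu]
    have : N (τ i) = fun ω => ∑ l ∈ Finset.range i, (N (σ (l + 1)) ω - N (σ l) ω) :=
      funext (hrep i hi)
    rw [this]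
    refine Finset.measurable_fun_sum _ fun l hl => ?_
    rw [measurable_iff_comap_le]
    have hl' : l ∈ Set.Iio (p + 1) := by
      have := Finset.mem_range.1 hl; simp only [Set.mem_Iio]; omega
    exact le_iSup₂ (f := fun l (_ : l ∈ Set.Iio (p + 1)) => MeasurableSpace.comap
      (fun ω => N (σ (l + 1)) ω - N (σ l) ω) inferInstance) l hl'
  · refine le_trans (le_of_eq ?_) (le_iSup₂ (f := fun l (_ : l ∈ ({p + 1} : Set ℕ)) =>
      MeasurableSpace.comap (fun ω => N (σ (l + 1)) ω - N (σ l) ω) inferInstance) (p + 1) rfl)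
    simp [σ]

end

section

variable {m : ℕ}

/-- Total size of the first `k` orders. -/
def orderSum (k : ℕ) (x : ℕ → Fin m → ℕ) (i : Fin m) : ℕ := ∑ r ∈ Finset.range k, x r i

lemma measurable_orderSum (k : ℕ) : Measurable (orderSum (m := m) k) := by
  unfold orderSum
  fun_prop

/-- The law of compound Poisson demand over a period of length `τ`, realized on the product of a
Poisson variable and an i.i.d. sequence of order sizes. -/
def cpLaw (lam : ℝ≥0) (ν : Measure (Fin m → ℕ)) (τ : ℝ) : Measure (Fin m → ℕ) :=
  ((poissonMeasure (lam * τ.toNNReal)).prod (Measure.infinitePi fun _ : ℕ => ν)).map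
    fun q => orderSum q.1 q.2

lemma measurable_orderSum_uncurry :
    Measurable fun q : ℕ × (ℕ → Fin m → ℕ) => orderSum q.1 q.2 :=
  measurable_from_prod_countable_right fun k => measurable_orderSum k

instance (lam : ℝ≥0) (ν : Measure (Fin m → ℕ)) [IsProbabilityMeasure ν] (τ : ℝ) :
    IsProbabilityMeasure (cpLaw lam ν τ) :=
  Measure.isProbabilityMeasure_map measurable_orderSum_uncurry.aemeasurable

lemma lintegral_cpLaw (lam : ℝ≥0) (ν : Measure (Fin m → ℕ)) [IsProbabilityMeasure ν] (τ : ℝ)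
    (f : (Fin m → ℕ) → ℝ≥0∞) :
    ∫⁻ w, f w ∂(cpLaw lam ν τ) = ∫⁻ k, ∫⁻ x, f (orderSum k x) ∂(Measure.infinitePi fun _ : ℕ => ν)
      ∂(poissonMeasure (lam * τ.toNNReal)) := by
  have hf : Measurable f := Measurable.of_discrete
  rw [cpLaw, lintegral_map hf measurable_orderSum_uncurry,
    lintegral_prod (fun q => f (orderSum q.1 q.2))
      (hf.comp measurable_orderSum_uncurry).aemeasurable]

/-- The demand between `s` and `t`, as a vector of natural numbers. -/
def inc {Ω : Type*} (D : ℝ → Ω → Fin m → ℕ) (s t : ℝ) (ω : Ω) (i : Fin m) : ℕ := D t ω i - D s ω i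

variable {Ω : Type*} [MeasurableSpace Ω] {P : Measure Ω} {t₀ : ℝ} {lam : ℝ≥0}
  {ν : Measure (Fin m → ℕ)} {D : ℝ → Ω → Fin m → ℕ}

lemma IsCompoundPoisson.mono (hD : IsCompoundPoisson P t₀ lam ν D) (ω : Ω) {s t : ℝ}
    (hst : s ≤ t) (i : Fin m) : D s ω i ≤ D t ω i := by
  obtain ⟨N, X, hN, -, -, -, -, hDN⟩ := hD
  rw [hDN, hDN]
  exact Finset.sum_le_sum_of_subset (Finset.range_mono (hN.mono ω hst))

lemma IsCompoundPoisson.eq_zero (hD : IsCompoundPoisson P t₀ lam ν D) (ω : Ω) {t : ℝ}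
    (ht : t ≤ t₀) : D t ω = 0 := by
  obtain ⟨N, X, hN, -, -, -, -, hDN⟩ := hD
  ext i
  simp [hDN, hN.eq_zero t ht ω]

lemma IsCompoundPoisson.measurable (hD : IsCompoundPoisson P t₀ lam ν D) (t : ℝ) :
    Measurable (D t) := by
  obtain ⟨N, X, hN, hX, -, -, -, hDN⟩ := hD
  have : D t = fun ω => orderSum (N t ω) fun r => X r ω := by
    ext ω i; exact hDN t ω i
  rw [this]
  exact measurable_orderSum_uncurry.comp
    ((hN.measurable t).prodMk (measurable_pi_iff.2 fun r => hX r))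

lemma history_le (hD : ∀ t, Measurable (D t)) (t : ℝ) :
    history D t ≤ (inferInstance : MeasurableSpace Ω) :=
  iSup₂_le fun s _ => (hD s).comap_le

omit [MeasurableSpace Ω] in
lemma history_mono {s t : ℝ} (hst : s ≤ t) : history D s ≤ history D t :=
  biSup_mono fun _ hu => le_trans hu hst

omit [MeasurableSpace Ω] in
lemma measurable_history {s t : ℝ} (hst : s ≤ t) : Measurable[history D t] (D s) := by
  rw [measurable_iff_comap_le]
  exact le_iSup₂ (f := fun s (_ : s ∈ Set.Iic t) => MeasurableSpace.comap (D s) inferInstance) s hst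

omit [MeasurableSpace Ω] in
lemma measurable_sum_ite {G : MeasurableSpace Ω} {N : Ω → ℕ} {X : ℕ → Ω → Fin m → ℕ} {n : ℕ}
    (hN : Measurable N) (hX : ∀ r < n, Measurable (X r)) :
    Measurable fun ω (i : Fin m) => ∑ r ∈ Finset.range n, if r < N ω then X r ω i else 0 := by
  refine measurable_pi_iff.2 fun i => Finset.measurable_fun_sum _ fun r hr => ?_
  exact Measurable.ite (hN (measurableSet_Ioi (a := r)))
    ((measurable_pi_apply i).comp (hX r (Finset.mem_range.1 hr))) measurable_const

omit [MeasurableSpace Ω] in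
/-- On the event that `n` orders have arrived by time `s`, the history up to time `s` is determined
by the arrival process up to time `s` and the first `n` order sizes. -/
lemma exists_trace_eq {N : ℝ → Ω → ℕ} {X : ℕ → Ω → Fin m → ℕ} (hNm : ∀ ω, Monotone fun t => N t ω)
    (hDN : ∀ t ω i, D t ω i = ∑ r ∈ Finset.range (N t ω), X r ω i) (s : ℝ) (n : ℕ) {A : Set Ω}
    (hA : MeasurableSet[history D s] A) :
    ∃ A', MeasurableSet[arrivalHistory N s ⊔ orderSigma X (Set.Iio n)] A' ∧
      A ∩ N s ⁻¹' {n} = A' ∩ N s ⁻¹' {n} := by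
  let e : (N s ⁻¹' {n} : Set Ω) → Ω := Subtype.val
  have hle : (history D s).comap e ≤ (arrivalHistory N s ⊔ orderSigma X (Set.Iio n)).comap e := by
    simp only [history, MeasurableSpace.comap_iSup, MeasurableSpace.comap_comp]
    refine iSup₂_le fun u hu => ?_
    let g : Ω → Fin m → ℕ := fun ω i => ∑ r ∈ Finset.range n, if r < N u ω then X r ω i else 0
    have hNu : Measurable[arrivalHistory N s ⊔ orderSigma X (Set.Iio n)] (N u) := by
      rw [measurable_iff_comap_le]
      exact (le_iSup (fun u : Set.Iic s => MeasurableSpace.comap (N u) inferInstance)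
        ⟨u, hu⟩).trans le_sup_left
    have hXr : ∀ r < n, Measurable[arrivalHistory N s ⊔ orderSigma X (Set.Iio n)] (X r) := by
      intro r hr
      rw [measurable_iff_comap_le]
      exact (le_iSup₂ (f := fun r (_ : r ∈ Set.Iio n) =>
        MeasurableSpace.comap (X r) inferInstance) r hr).trans le_sup_right
    have hg : Measurable[arrivalHistory N s ⊔ orderSigma X (Set.Iio n)] g :=
      measurable_sum_ite hNu hXr
    have hDg : D u ∘ e = g ∘ e := by
      ext ⟨ω, hω⟩ i
      have hω' : N s ω = n := hω
      have hun : N u ω ≤ n := hω' ▸ hNm ω hu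
      simp only [e, g, Function.comp, hDN]
      rw [← Finset.sum_filter]
      refine Finset.sum_congr ?_ fun _ _ => rfl
      ext r
      simp only [Finset.mem_range, Finset.mem_filter]
      omega
    rw [hDg, ← MeasurableSpace.comap_comp]
    exact MeasurableSpace.comap_mono (measurable_iff_comap_le.1 hg)
  obtain ⟨A', hA', hAA⟩ := hle _ ⟨A, hA, rfl⟩
  refine ⟨A', hA', ?_⟩
  have := congrArg (fun B => e '' B) hAA
  simp only [e, Subtype.image_preimage_coe] at this
  rw [Set.inter_comm A, Set.inter_comm A', this]

omit [MeasurableSpace Ω] in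
lemma arrivalHistory_sup_le {N : ℝ → Ω → ℕ} (s t : ℝ) :
    arrivalHistory N s ⊔ MeasurableSpace.comap (fun ω => N t ω - N s ω) inferInstance ≤
      MeasurableSpace.comap (fun ω t => N t ω) inferInstance := by
  have h : ∀ u, Measurable[MeasurableSpace.comap (fun ω t => N t ω) inferInstance] (N u) :=
    fun u => measurable_iff_comap_le.2 (by
      have : N u = (fun f : ℝ → ℕ => f u) ∘ fun ω t => N t ω := rfl
      conv_lhs => rw [this, ← MeasurableSpace.comap_comp]
      exact MeasurableSpace.comap_mono (measurable_pi_apply u).comap_le)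
  exact sup_le (iSup_le fun u => (h u).comap_le)
    (measurable_iff_comap_le.1 (Measurable.sub (h t) (h s)))

omit [MeasurableSpace Ω] in
lemma orderSigma_le_comap {X : ℕ → Ω → Fin m → ℕ} (T : Set ℕ) :
    orderSigma X T ≤ MeasurableSpace.comap (fun ω r => X r ω) inferInstance :=
  iSup₂_le fun r _ => by
    have : X r = (fun f : ℕ → Fin m → ℕ => f r) ∘ fun ω r => X r ω := rfl
    conv_lhs => rw [this, ← MeasurableSpace.comap_comp]
    exact MeasurableSpace.comap_mono (measurable_pi_apply r).comap_le

lemma orderSigma_le {X : ℕ → Ω → Fin m → ℕ} (hX : ∀ r, Measurable (X r)) (T : Set ℕ) :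
    orderSigma X T ≤ (inferInstance : MeasurableSpace Ω) :=
  iSup₂_le fun r _ => (hX r).comap_le

/-- Arrivals up to time `s` and the first `n` orders are independent of later arrivals and later
orders. -/
lemma indep_past_future [IsProbabilityMeasure P] {N : ℝ → Ω → ℕ} {X : ℕ → Ω → Fin m → ℕ}
    (hN : IsPoissonProcess P t₀ lam N) (hX : ∀ r, Measurable (X r)) (hXind : iIndepFun X P)
    (hNX : IndepFun (fun ω t => N t ω) (fun ω r => X r ω) P) {s t : ℝ} (hst : s ≤ t) (n : ℕ) :
    Indep (arrivalHistory N s ⊔ orderSigma X (Set.Iio n))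
      (MeasurableSpace.comap (fun ω => N t ω - N s ω) inferInstance ⊔ orderSigma X (Set.Ici n))
      P := by
  have hX12 : Indep (orderSigma X (Set.Iio n)) (orderSigma X (Set.Ici n)) P :=
    indep_iSup_of_disjoint (fun r => (hX r).comap_le) ((iIndepFun_iff_iIndep _ _ _).1 hXind) (by
        rw [Set.disjoint_left]; intro a ha hb; exact absurd (Set.mem_Iio.1 ha) (not_lt.2 hb))
  exact indep_sup_sup (iSup_le fun u => (hN.measurable u).comap_le)
    ((hN.measurable t).sub (hN.measurable s)).comap_le (orderSigma_le hX _) (orderSigma_le hX _)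
    (hN.indep_past hst) hX12 (indep_of_indep_of_le ((IndepFun_iff_Indep _ _ _).1 hNX)
      (arrivalHistory_sup_le s t) (sup_le (orderSigma_le_comap _) (orderSigma_le_comap _)))

/-- Demand between `s` and `t` is independent of the history up to time `s`, and its law depends
on `t - s` only. -/
lemma IsCompoundPoisson.measure_inter_inc [IsProbabilityMeasure P] [IsProbabilityMeasure ν]
    (hD : IsCompoundPoisson P t₀ lam ν D) {s t : ℝ}
    (hs : t₀ ≤ s) (hst : s ≤ t) {A : Set Ω} (hA : MeasurableSet[history D s] A)
    (B : Set (Fin m → ℕ)) :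
    P (A ∩ inc D s t ⁻¹' B) = P A * cpLaw lam ν (t - s) B := by
  have hDm := hD.measurable
  obtain ⟨N, X, hN, hXm, hXlaw, hXind, hNX, hDN⟩ := hD
  have hB : MeasurableSet B := MeasurableSet.of_discrete
  have hA₀ : MeasurableSet A := history_le hDm s A hA
  have hNs := hN.measurable s
  have hΔ : Measurable fun ω => N t ω - N s ω := (hN.measurable t).sub hNs
  let Sm : ℕ → ℕ → Ω → Fin m → ℕ := fun n k ω => orderSum k fun r => X (n + r) ω
  have hSm : ∀ n k, Measurable (Sm n k) := fun n k =>
    (measurable_orderSum k).comp (measurable_pi_iff.2 fun r => hXm _)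
  -- the law of the total size of `k` consecutive orders
  have hSlaw : ∀ n k, P (Sm n k ⁻¹' B) =
      (Measure.infinitePi fun _ : ℕ => ν) (orderSum k ⁻¹' B) := by
    intro n k
    have h1 : iIndepFun (fun r => X (n + r)) P := hXind.precomp (add_right_injective n)
    have h2 := h1.map_fun_eq_infinitePi_map fun r => hXm (n + r)
    simp only [hXlaw] at h2
    rw [← h2, Measure.map_apply (measurable_pi_iff.2 fun r => hXm (n + r))
      (measurable_orderSum k hB)]
    rfl
  have hNX' := (IndepFun_iff_Indep _ _ _).1 hNX
  -- for each number `n` of orders up to time `s` and each number `k` of orders thereafter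
  have key : ∀ n k, P ((A ∩ inc D s t ⁻¹' B) ∩ (N s ⁻¹' {n} ∩ (fun ω => N t ω - N s ω) ⁻¹' {k})) =
      P (A ∩ N s ⁻¹' {n}) * (poissonMeasure (lam * (t - s).toNNReal) {k} *
        (Measure.infinitePi fun _ : ℕ => ν) (orderSum k ⁻¹' B)) := by
    intro n k
    obtain ⟨A', hA', hAA⟩ := exists_trace_eq hN.mono hDN s n hA
    have hind := indep_past_future hN hXm hXind hNX hst n
    have hset : (A ∩ inc D s t ⁻¹' B) ∩ (N s ⁻¹' {n} ∩ (fun ω => N t ω - N s ω) ⁻¹' {k}) =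
        (A' ∩ N s ⁻¹' {n}) ∩ ((fun ω => N t ω - N s ω) ⁻¹' {k} ∩ Sm n k ⁻¹' B) := by
      rw [← hAA]
      ext ω
      simp only [Set.mem_inter_iff, Set.mem_preimage, Set.mem_singleton_iff]
      have : N s ω = n → N t ω - N s ω = k → inc D s t ω = Sm n k ω := by
        intro h1 h2
        ext i
        have h3 : N t ω = n + k := by have := hN.mono ω hst; simp only at this; omega
        simp only [inc, hDN, Sm, orderSum, h1, h3, Finset.sum_range_add]
        omega
      constructor
      · rintro ⟨⟨h1, h2⟩, h3, h4⟩
        exact ⟨⟨h1, h3⟩, h4, this h3 h4 ▸ h2⟩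
      · rintro ⟨⟨h1, h3⟩, h4, h2⟩
        exact ⟨⟨h1, this h3 h4 ▸ h2⟩, h3, h4⟩
    have hNs' : MeasurableSet[arrivalHistory N s] (N s ⁻¹' {n}) :=
      le_iSup (fun u : Set.Iic s => MeasurableSpace.comap (N u) inferInstance) ⟨s, le_refl s⟩ _
        ⟨{n}, MeasurableSet.of_discrete, rfl⟩
    have hΔ' : MeasurableSet[MeasurableSpace.comap (fun ω => N t ω - N s ω) inferInstance]
        ((fun ω => N t ω - N s ω) ⁻¹' {k}) :=
      ⟨{k}, MeasurableSet.of_discrete, rfl⟩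
    have hS' : MeasurableSet[orderSigma X (Set.Ici n)] (Sm n k ⁻¹' B) := by
      have : Measurable[orderSigma X (Set.Ici n)] (Sm n k) := by
        refine (measurable_orderSum k).comp (@measurable_pi_lambda _ _ _ (_) _ _ fun r => ?_)
        rw [measurable_iff_comap_le]
        exact le_iSup₂ (f := fun r (_ : r ∈ Set.Ici n) =>
          MeasurableSpace.comap (X r) inferInstance) (n + r) (Nat.le_add_right n r)
      exact this hB
    have hPkS := (Indep_iff _ _ _).1 hNX' _ _
      (arrivalHistory_sup_le s t _ (le_sup_right (a := arrivalHistory N s) _ hΔ'))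
      (orderSigma_le_comap _ _ hS')
    rw [hset, (Indep_iff _ _ _).1 hind _ _ (hA'.inter (le_sup_left (a := arrivalHistory N s) _ hNs'))
        (MeasurableSet.inter (le_sup_left (b := orderSigma X (Set.Ici n)) _ hΔ')
          (le_sup_right (b := orderSigma X (Set.Ici n)) _ hS')), ← hAA, hPkS,
      hSlaw, ← hN.law s t hs hst, Measure.map_apply hΔ MeasurableSet.of_discrete]
  have hcp : cpLaw lam ν (t - s) B = ∑' k, poissonMeasure (lam * (t - s).toNNReal) {k} *
        (Measure.infinitePi fun _ : ℕ => ν) (orderSum k ⁻¹' B) := by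
    rw [cpLaw, Measure.map_apply measurable_orderSum_uncurry hB,
      Measure.prod_apply (measurable_orderSum_uncurry hB), lintegral_countable']
    simp only [mul_comm]
    rfl
  have split : ∀ (f : Ω → ℕ) (_ : Measurable f) (E : Set Ω) (_ : MeasurableSet E),
      P E = ∑' n, P (E ∩ f ⁻¹' {n}) := by
    intro f hf E hE
    rw [← measure_iUnion]
    · congr 1
      ext ω
      simp
    · intro a b hab
      refine Set.disjoint_left.2 ?_
      rintro ω ⟨-, h1⟩ ⟨-, h2⟩
      exact hab (h1.symm.trans h2)
    · exact fun n => hE.inter (hf MeasurableSet.of_discrete)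
  have hinc : Measurable (inc D s t) := by
    refine measurable_pi_iff.2 fun i => ?_
    exact ((measurable_pi_apply i).comp (hDm t)).sub ((measurable_pi_apply i).comp (hDm s))
  have hE : MeasurableSet (A ∩ inc D s t ⁻¹' B) := hA₀.inter (hinc hB)
  rw [split _ hNs _ hE, split _ hNs _ hA₀, ← ENNReal.tsum_mul_right]
  refine tsum_congr fun n => ?_
  rw [split _ hΔ _ (hE.inter (hNs MeasurableSet.of_discrete)), hcp, ← ENNReal.tsum_mul_left]
  refine tsum_congr fun k => ?_
  rw [Set.inter_assoc, key n k]

lemma IsCompoundPoisson.measurable_inc (hD : IsCompoundPoisson P t₀ lam ν D) (s t : ℝ) :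
    Measurable (inc D s t) :=
  measurable_pi_iff.2 fun i => ((measurable_pi_apply i).comp (hD.measurable t)).sub
    ((measurable_pi_apply i).comp (hD.measurable s))

lemma IsCompoundPoisson.map_inc [IsProbabilityMeasure P] [IsProbabilityMeasure ν]
    (hD : IsCompoundPoisson P t₀ lam ν D) {s t : ℝ} (hs : t₀ ≤ s) (hst : s ≤ t) :
    P.map (inc D s t) = cpLaw lam ν (t - s) := by
  ext B hB
  rw [Measure.map_apply (hD.measurable_inc s t) hB]
  simpa using hD.measure_inter_inc hs hst (A := Set.univ) MeasurableSet.univ B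

/-- Expectations of functions of the history and of later demand, by conditioning on the history. -/
lemma IsCompoundPoisson.lintegral_history_inc [IsProbabilityMeasure P] [IsProbabilityMeasure ν]
    (hD : IsCompoundPoisson P t₀ lam ν D) {s t : ℝ} (hs : t₀ ≤ s) (hst : s ≤ t)
    {E : Type*} [MeasurableSpace E] {U : Ω → E} (hU : Measurable[history D s] U)
    {f : E × (Fin m → ℕ) → ℝ≥0∞} (hf : Measurable f) :
    ∫⁻ ω, f (U ω, inc D s t ω) ∂P = ∫⁻ ω, ∫⁻ w, f (U ω, w) ∂(cpLaw lam ν (t - s)) ∂P := by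
  have hU₀ : Measurable U := hU.mono (history_le hD.measurable s) le_rfl
  have hI := hD.measurable_inc s t
  have hind : IndepFun U (inc D s t) P := by
    rw [IndepFun_iff]
    rintro _ _ ⟨u, hu, rfl⟩ ⟨B, hB, rfl⟩
    have h1 := hD.measure_inter_inc hs hst (hU hu) B
    rw [h1, ← hD.map_inc hs hst, Measure.map_apply hI hB]
  have hmap := (indepFun_iff_map_prod_eq_prod_map_map hU₀.aemeasurable hI.aemeasurable).1 hind
  rw [hD.map_inc hs hst] at hmap
  have : IsProbabilityMeasure (P.map U) := Measure.isProbabilityMeasure_map hU₀.aemeasurable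
  rw [← lintegral_map (f := f) (g := fun ω => (U ω, inc D s t ω)) hf (hU₀.prodMk hI), hmap,
    lintegral_prod _ hf.aemeasurable, lintegral_map hf.lintegral_prod_right' hU₀]

end

/-! ### Moments and dispersion of compound Poisson demand -/

lemma integrable_natCast_poissonMeasure (r : ℝ≥0) :
    Integrable (fun k : ℕ => (k : ℝ)) (poissonMeasure r) := by
  rw [integrable_poissonMeasure_iff, ← summable_nat_add_iff 1]
  have h := (hasSum_one_poissonMeasure r).summable.mul_left (r : ℝ)
  refine h.congr fun k => ?_
  rw [Real.norm_eq_abs, Nat.abs_cast, Nat.factorial_succ]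
  push_cast
  field_simp
  ring

/-- Mean absolute deviations of a Poisson variable from any point are of the order of the standard
deviation. This follows from `1 - cos u ≤ |u|` and the form of the characteristic function. -/
lemma poisson_dispersion {r : ℝ≥0} (hr : 1 ≤ r) (a : ℝ) :
    (1 - Real.exp (-(2 / Real.pi ^ 2))) * √r ≤ ∫ k : ℕ, |(k : ℝ) - a| ∂(poissonMeasure r) := by
  have hr' : (1 : ℝ) ≤ r := by exact_mod_cast hr
  have hs : 1 ≤ √(r : ℝ) := Real.one_le_sqrt.2 hr'
  have hs0 : 0 < √(r : ℝ) := by linarith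
  set θ : ℝ := 1 / √r with hθ
  have hθ0 : 0 < θ := by positivity
  have hθ1 : θ ≤ 1 := by rw [hθ, div_le_one hs0]; exact hs
  have hθ2 : (r : ℝ) * θ ^ 2 = 1 := by
    rw [hθ, div_pow, one_pow, Real.sq_sqrt (by linarith)]; field_simp
  have hint : Integrable (fun k : ℕ => |(k : ℝ) - a|) (poissonMeasure r) :=
    ((integrable_natCast_poissonMeasure r).sub (integrable_const a)).abs
  have hcosint : Integrable (fun k : ℕ => Real.cos (θ * (k - a))) (poissonMeasure r) :=
    Integrable.of_bound (C := 1) (Measurable.of_discrete.aestronglyMeasurable)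
      (Eventually.of_forall fun k => Real.abs_cos_le_one _)
  have hnorm : ‖charFun ((poissonMeasure r).map (Nat.cast : ℕ → ℝ)) θ‖ ≤
      Real.exp (-(2 / Real.pi ^ 2)) := by
    rw [charFun_map_cast_poissonMeasure, Complex.norm_exp]
    have h1 : ((r : ℂ) * (Complex.exp (θ * Complex.I) - 1)).re = r * (Real.cos θ - 1) := by
      have : ((r : ℂ)) = ((r : ℝ) : ℂ) := rfl
      rw [this, Complex.re_ofReal_mul, Complex.sub_re, Complex.exp_ofReal_mul_I_re, Complex.one_re]
    have hcos : Real.cos θ ≤ 1 - 2 / Real.pi ^ 2 * θ ^ 2 := Real.cos_le_one_sub_mul_cos_sq (by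
      rw [abs_of_pos hθ0]; linarith [Real.pi_gt_three])
    rw [h1, Real.exp_le_exp]
    calc (r : ℝ) * (Real.cos θ - 1) ≤ r * (-(2 / Real.pi ^ 2 * θ ^ 2)) := by
          gcongr; linarith
      _ = -(2 / Real.pi ^ 2) * (r * θ ^ 2) := by ring
      _ = _ := by rw [hθ2, mul_one]
  have hcos_le : ∫ k : ℕ, Real.cos (θ * (k - a)) ∂(poissonMeasure r) ≤
      Real.exp (-(2 / Real.pi ^ 2)) := by
    have hexpint : Integrable (fun k : ℕ => Complex.exp ((θ * (k - a) : ℝ) * Complex.I))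
        (poissonMeasure r) :=
      Integrable.of_bound (C := 1) (Measurable.of_discrete.aestronglyMeasurable)
        (Eventually.of_forall fun k => by rw [Complex.norm_exp_ofReal_mul_I])
    have h1 : ∫ k : ℕ, Real.cos (θ * (k - a)) ∂(poissonMeasure r) =
        (∫ k : ℕ, Complex.exp ((θ * (k - a) : ℝ) * Complex.I) ∂(poissonMeasure r)).re := by
      have h := integral_re (𝕜 := ℂ) hexpint
      refine Eq.trans ?_ h
      exact integral_congr_ae (Eventually.of_forall fun k => (Complex.exp_ofReal_mul_I_re _).symm)
    have h2 : ∫ k : ℕ, Complex.exp ((θ * (k - a) : ℝ) * Complex.I) ∂(poissonMeasure r) =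
        Complex.exp ((-(θ * a) : ℝ) * Complex.I) *
          charFun ((poissonMeasure r).map (Nat.cast : ℕ → ℝ)) θ := by
      rw [charFun_apply_real, integral_map .of_discrete (by fun_prop), ← integral_const_mul]
      congr 1
      ext k
      rw [← Complex.exp_add]
      congr 1
      push_cast
      ring
    rw [h1, h2]
    refine (Complex.re_le_norm _).trans ?_
    rwa [norm_mul, Complex.norm_exp_ofReal_mul_I, one_mul]
  have hpt : ∀ k : ℕ, 1 - Real.cos (θ * (k - a)) ≤ θ * |(k : ℝ) - a| := by
    intro k
    have h := Real.abs_cos_sub_cos_le 0 (θ * (k - a))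
    rw [Real.cos_zero, zero_sub, abs_neg, abs_mul, abs_of_pos hθ0] at h
    exact (le_abs_self _).trans h
  have hmono : ∫ k : ℕ, (1 - Real.cos (θ * (k - a))) ∂(poissonMeasure r) ≤
      ∫ k : ℕ, θ * |(k : ℝ) - a| ∂(poissonMeasure r) :=
    integral_mono ((integrable_const 1).sub hcosint) (hint.const_mul θ) hpt
  rw [integral_sub (integrable_const 1) hcosint, integral_const_mul] at hmono
  simp only [integral_const, probReal_univ, smul_eq_mul, one_mul] at hmono
  have h3 : 1 - Real.exp (-(2 / Real.pi ^ 2)) ≤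
      θ * ∫ k : ℕ, |(k : ℝ) - a| ∂(poissonMeasure r) := by linarith
  have h4 := mul_le_mul_of_nonneg_left h3 hs0.le
  have h5 : √(r : ℝ) * θ = 1 := by rw [hθ]; field_simp
  calc _ = √(r : ℝ) * (1 - Real.exp (-(2 / Real.pi ^ 2))) := by ring
    _ ≤ _ := h4
    _ = _ := by rw [← mul_assoc, h5, one_mul]

section

variable {m : ℕ} {lam : ℝ≥0} {ν : Measure (Fin m → ℕ)} [IsProbabilityMeasure ν]

lemma integrable_order (hν : ∀ i, Integrable (fun s : Fin m → ℕ => (s i : ℝ)) ν) (r : ℕ)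
    (i : Fin m) : Integrable (fun x : ℕ → Fin m → ℕ => (x r i : ℝ))
      (Measure.infinitePi fun _ : ℕ => ν) :=
  (measurePreserving_eval_infinitePi (fun _ : ℕ => ν) r).integrable_comp_of_integrable (hν i)

lemma integral_order (r : ℕ) (i : Fin m) :
    ∫ x : ℕ → Fin m → ℕ, (x r i : ℝ) ∂(Measure.infinitePi fun _ : ℕ => ν) =
      ∫ s : Fin m → ℕ, (s i : ℝ) ∂ν := by
  have hf : AEStronglyMeasurable (fun s : Fin m → ℕ => (s i : ℝ))
      ((Measure.infinitePi fun _ : ℕ => ν).map fun x : ℕ → Fin m → ℕ => x r) :=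
    Measurable.of_discrete.aestronglyMeasurable
  have hm : Measurable fun x : ℕ → Fin m → ℕ => x r := measurable_pi_apply r
  have h := integral_map hm.aemeasurable hf
  rw [Measure.infinitePi_map_eval] at h
  exact h.symm

lemma integrable_cpLaw (hν : ∀ i, Integrable (fun s : Fin m → ℕ => (s i : ℝ)) ν) (τ : ℝ)
    (i : Fin m) : Integrable (fun w : Fin m → ℕ => (w i : ℝ)) (cpLaw lam ν τ) := by
  refine ⟨Measurable.of_discrete.aestronglyMeasurable, ?_⟩
  rw [HasFiniteIntegral, lintegral_cpLaw]
  have hE : ∫⁻ s : Fin m → ℕ, ‖(s i : ℝ)‖ₑ ∂ν < ∞ := (hν i).2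
  have h1 : ∀ r : ℕ, ∫⁻ x : ℕ → Fin m → ℕ, ‖(x r i : ℝ)‖ₑ ∂(Measure.infinitePi fun _ : ℕ => ν) =
      ∫⁻ s : Fin m → ℕ, ‖(s i : ℝ)‖ₑ ∂ν := fun r =>
    (measurePreserving_eval_infinitePi (fun _ : ℕ => ν) r).lintegral_comp
      (f := fun s : Fin m → ℕ => ‖(s i : ℝ)‖ₑ) Measurable.of_discrete
  have h2 : ∀ k : ℕ, ∫⁻ x, ‖(orderSum k x i : ℝ)‖ₑ ∂(Measure.infinitePi fun _ : ℕ => ν) ≤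
      ‖(k : ℝ)‖ₑ * ∫⁻ s : Fin m → ℕ, ‖(s i : ℝ)‖ₑ ∂ν := by
    intro k
    calc ∫⁻ x, ‖(orderSum k x i : ℝ)‖ₑ ∂(Measure.infinitePi fun _ : ℕ => ν)
        ≤ ∫⁻ x : ℕ → Fin m → ℕ, ∑ r ∈ Finset.range k, ‖(x r i : ℝ)‖ₑ
            ∂(Measure.infinitePi fun _ : ℕ => ν) := by
          refine lintegral_mono fun x => ?_
          simp only [orderSum, Nat.cast_sum]
          exact enorm_sum_le _ _
      _ = ∑ r ∈ Finset.range k, ∫⁻ s : Fin m → ℕ, ‖(s i : ℝ)‖ₑ ∂ν := by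
          rw [lintegral_finsetSum _ fun r _ => by fun_prop]
          simp only [h1]
      _ = _ := by
          rw [Finset.sum_const, Finset.card_range, nsmul_eq_mul]
          congr 1
          simp
  refine (lintegral_mono h2).trans_lt ?_
  rw [lintegral_mul_const _ Measurable.of_discrete]
  exact ENNReal.mul_lt_top (integrable_natCast_poissonMeasure _).2 hE

/-- The mean absolute deviation of a linear function of compound Poisson demand grows at least like
the square root of the expected number of orders: by Jensen's inequality, order sizes can be
replaced with their means. -/
lemma cpLaw_dispersion (hν : ∀ i, Integrable (fun s : Fin m → ℕ => (s i : ℝ)) ν) (τ : ℝ)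
    (hτ : 1 ≤ lam * τ.toNNReal) (c : Fin m → ℝ) (hc : 0 < ∑ i, c i * ∫ s, (s i : ℝ) ∂ν) (a : ℝ) :
    ENNReal.ofReal ((∑ i, c i * ∫ s, (s i : ℝ) ∂ν) * ((1 - Real.exp (-(2 / Real.pi ^ 2))) *
      √(lam * τ.toNNReal : ℝ≥0))) ≤
      ∫⁻ w, ENNReal.ofReal |∑ i, c i * (w i : ℝ) - a| ∂(cpLaw lam ν τ) := by
  set μ := ∑ i, c i * ∫ s, (s i : ℝ) ∂ν with hμ
  rw [lintegral_cpLaw]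
  have h1 : ∀ k : ℕ, ENNReal.ofReal (μ * |(k : ℝ) - a / μ|) ≤
      ∫⁻ x, ENNReal.ofReal |∑ i, c i * (orderSum k x i : ℝ) - a|
        ∂(Measure.infinitePi fun _ : ℕ => ν) := by
    intro k
    have hint : Integrable (fun x : ℕ → Fin m → ℕ => ∑ i, c i * (orderSum k x i : ℝ))
        (Measure.infinitePi fun _ : ℕ => ν) := by
      refine integrable_finsetSum _ fun i _ => Integrable.const_mul ?_ _
      simp only [orderSum, Nat.cast_sum]
      exact integrable_finsetSum _ fun r _ => integrable_order hν r i
    have hval : ∫ x : ℕ → Fin m → ℕ, (∑ i, c i * (orderSum k x i : ℝ) - a)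
        ∂(Measure.infinitePi fun _ : ℕ => ν) = μ * (k - a / μ) := by
      rw [integral_sub hint (integrable_const a), integral_finsetSum _ fun i _ => ?_]
      · simp only [integral_const_mul, orderSum, Nat.cast_sum]
        simp only [integral_finsetSum _ fun r (_ : r ∈ Finset.range k) => integrable_order hν r _,
          integral_order, Finset.sum_const, Finset.card_range, nsmul_eq_mul, integral_const,
          probReal_univ, one_smul]
        rw [mul_sub, mul_div_cancel₀ _ hc.ne', hμ, Finset.sum_mul]
        congr 1
        exact Finset.sum_congr rfl fun i _ => by ring
      · refine Integrable.const_mul ?_ _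
        simp only [orderSum, Nat.cast_sum]
        exact integrable_finsetSum _ fun r _ => integrable_order hν r i
    have := enorm_integral_le_lintegral_enorm (μ := Measure.infinitePi fun _ : ℕ => ν)
      fun x : ℕ → Fin m → ℕ => ∑ i, c i * (orderSum k x i : ℝ) - a
    rw [hval] at this
    simp only [Real.enorm_eq_ofReal_abs, abs_mul, abs_of_pos hc] at this
    exact this
  refine le_trans ?_ (lintegral_mono h1)
  have hint : Integrable (fun k : ℕ => μ * |(k : ℝ) - a / μ|)
      (poissonMeasure (lam * τ.toNNReal)) :=
    ((integrable_natCast_poissonMeasure _).sub (integrable_const _)).abs.const_mul μ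
  rw [← ofReal_integral_eq_lintegral_ofReal hint (Eventually.of_forall fun k =>
    mul_nonneg hc.le (abs_nonneg _)), integral_const_mul]
  exact ENNReal.ofReal_le_ofReal (mul_le_mul_of_nonneg_left (poisson_dispersion hτ _) hc.le)

end

/-! ### The allocation problem for a given component balance -/

section

variable {m n : ℕ} (S : Spec m n)

lemma Spec.usage_add (j : Fin n) (x x' : Fin m → ℝ) :
    S.usage j (x + x') = S.usage j x + S.usage j x' := by
  simp [Spec.usage, mul_add, Finset.sum_add_distrib]

lemma Spec.usage_sub (j : Fin n) (x x' : Fin m → ℝ) :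
    S.usage j (x - x') = S.usage j x - S.usage j x' := by
  simp [Spec.usage, mul_sub, Finset.sum_sub_distrib]

lemma Spec.usage_zero (j : Fin n) : S.usage j 0 = 0 := by simp [Spec.usage]

lemma Spec.usage_nonneg (j : Fin n) {x : Fin m → ℝ} (h : 0 ≤ x) : 0 ≤ S.usage j x :=
  Finset.sum_nonneg fun i _ => mul_nonneg (Nat.cast_nonneg _) (h i)

/-- Amount of component `j` in one unit of every product. -/
def Spec.rowSum (j : Fin n) : ℝ := ∑ i, (S.A j i : ℝ)

lemma Spec.usage_const (j : Fin n) (s : ℝ) : S.usage j (fun _ => s) = s * S.rowSum j := by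
  rw [Spec.usage, Spec.rowSum, Finset.mul_sum]
  exact Finset.sum_congr rfl fun i _ => mul_comm _ _

lemma Spec.one_le_rowSum (j : Fin n) : 1 ≤ S.rowSum j := by
  obtain ⟨i, hi⟩ := S.row_ne_zero j
  have h1 : (1 : ℝ) ≤ S.A j i := by exact_mod_cast Nat.one_le_iff_ne_zero.2 hi
  exact h1.trans (Finset.single_le_sum (f := fun i => (S.A j i : ℝ))
    (fun i _ => Nat.cast_nonneg _) (Finset.mem_univ i))

lemma Spec.abs_usage_le (j : Fin n) {x : Fin m → ℝ} {s : ℝ} (h : ∀ i, |x i| ≤ s) :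
    |S.usage j x| ≤ S.rowSum j * s := by
  rw [Spec.usage, Spec.rowSum, Finset.sum_mul]
  refine (Finset.abs_sum_le_sum_abs _ _).trans (Finset.sum_le_sum fun i _ => ?_)
  rw [abs_mul, Nat.abs_cast]
  exact mul_le_mul_of_nonneg_left (h i) (Nat.cast_nonneg _)

lemma Spec.c_pos (i : Fin m) : 0 < S.c i :=
  add_pos_of_pos_of_nonneg (S.b_pos i)
    (Finset.sum_nonneg fun j _ => mul_nonneg (Nat.cast_nonneg _) (S.h_pos j).le)

lemma Spec.sum_c_mul (x : Fin m → ℝ) :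
    ∑ i, S.c i * x i = ∑ i, S.b i * x i + ∑ j, S.h j * S.usage j x := by
  simp only [Spec.c, add_mul, Finset.sum_add_distrib, Spec.usage, Finset.mul_sum, Finset.sum_mul]
  rw [Finset.sum_comm (s := Finset.univ (α := Fin m))]
  congr 1
  exact Finset.sum_congr rfl fun j _ => Finset.sum_congr rfl fun i _ => by ring

/-- Holding and backlog costs when the backlog is `β` and on-hand inventory is `A β - q`. -/
lemma Spec.cost_eq (q : Fin n → ℝ) (β : Fin m → ℝ) :
    ∑ i, S.c i * β i - ∑ j, S.h j * q j =
      ∑ i, S.b i * β i + ∑ j, S.h j * (S.usage j β - q j) := by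
  rw [S.sum_c_mul]
  simp only [mul_sub, Finset.sum_sub_distrib]
  ring

/-- Backlogs that leave nonnegative inventories when the component balance (demand over a lead time
less inventory position) is `q`. -/
def Spec.backlogs (q : Fin n → ℝ) : Set (Fin m → ℝ) := {β | 0 ≤ β ∧ ∀ j, q j ≤ S.usage j β}

/-- The smallest cost rate `b · β + h · (Aβ - q)` when the component balance is `q`. -/
def Spec.lpCost (q : Fin n → ℝ) : ℝ :=
  sInf ((fun β : Fin m → ℝ => ∑ i, S.c i * β i) '' S.backlogs q) - ∑ j, S.h j * q j

variable {S}

lemma Spec.le_sum_c_of_mem_backlogs {q : Fin n → ℝ} {β : Fin m → ℝ} (hβ : β ∈ S.backlogs q) :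
    ∑ j, S.h j * q j ≤ ∑ i, S.c i * β i := by
  have h := S.cost_eq q β
  have h1 : 0 ≤ ∑ i, S.b i * β i :=
    Finset.sum_nonneg fun i _ => mul_nonneg (S.b_pos i).le (hβ.1 i)
  have h2 : 0 ≤ ∑ j, S.h j * (S.usage j β - q j) :=
    Finset.sum_nonneg fun j _ => mul_nonneg (S.h_pos j).le (sub_nonneg.2 (hβ.2 j))
  linarith

lemma Spec.bddBelow_backlogs (q : Fin n → ℝ) :
    BddBelow ((fun β : Fin m → ℝ => ∑ i, S.c i * β i) '' S.backlogs q) := by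
  refine ⟨∑ j, S.h j * q j, ?_⟩
  rintro _ ⟨β, hβ, rfl⟩
  exact le_sum_c_of_mem_backlogs hβ

lemma Spec.backlogs_nonempty (q : Fin n → ℝ) : (S.backlogs q).Nonempty := by
  have h0 : 0 ≤ ∑ j, |q j| := Finset.sum_nonneg fun j _ => abs_nonneg _
  refine ⟨fun _ => ∑ j, |q j|, fun _ => h0, fun j => ?_⟩
  rw [S.usage_const]
  calc q j ≤ |q j| := le_abs_self _
    _ ≤ ∑ j, |q j| := Finset.single_le_sum (f := fun j => |q j|) (fun j _ => abs_nonneg _)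
        (Finset.mem_univ j)
    _ ≤ (∑ j, |q j|) * S.rowSum j := le_mul_of_one_le_right h0 (S.one_le_rowSum j)

lemma Spec.lpCost_le {q : Fin n → ℝ} {β : Fin m → ℝ} (hβ : β ∈ S.backlogs q) :
    S.lpCost q ≤ ∑ i, S.c i * β i - ∑ j, S.h j * q j :=
  sub_le_sub_right (csInf_le (bddBelow_backlogs q) ⟨β, hβ, rfl⟩) _

lemma Spec.le_lpCost {q : Fin n → ℝ} {r : ℝ}
    (h : ∀ β ∈ S.backlogs q, r ≤ ∑ i, S.c i * β i - ∑ j, S.h j * q j) : r ≤ S.lpCost q := by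
  rw [Spec.lpCost, le_sub_iff_add_le]
  refine le_csInf ((backlogs_nonempty q).image _) ?_
  rintro _ ⟨β, hβ, rfl⟩
  linarith [h β hβ]

lemma Spec.lpCost_nonneg (q : Fin n → ℝ) : 0 ≤ S.lpCost q :=
  le_lpCost fun _ hβ => sub_nonneg.2 (le_sum_c_of_mem_backlogs hβ)

lemma Spec.exists_lt_lpCost_add (q : Fin n → ℝ) {ε : ℝ} (hε : 0 < ε) :
    ∃ β ∈ S.backlogs q, ∑ i, S.c i * β i - ∑ j, S.h j * q j < S.lpCost q + ε := by
  by_contra! h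
  linarith [le_lpCost h]

lemma IsBacklogOptimal.lpCost_eq {q : Fin n → ℝ} {β : Fin m → ℝ} (hβ : IsBacklogOptimal S q β) :
    S.lpCost q = ∑ i, S.c i * β i - ∑ j, S.h j * q j :=
  le_antisymm (Spec.lpCost_le hβ.2) (Spec.le_lpCost fun _ hβ' => sub_le_sub_right (hβ.1 hβ') _)

/-- Lipschitz continuity of `lpCost`: an additional backlog of `s` units of every product makes up
for an increase of the component balance by `s`. -/
lemma Spec.lpCost_le_add {q q' : Fin n → ℝ} {s : ℝ} (hs : 0 ≤ s) (h : ∀ j, |q j - q' j| ≤ s) :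
    S.lpCost q ≤ S.lpCost q' + (∑ i, S.c i + ∑ j, S.h j) * s := by
  rw [← sub_le_iff_le_add]
  refine le_lpCost fun β hβ => ?_
  have hfeas : (fun i => β i + s) ∈ S.backlogs q := by
    refine ⟨fun i => add_nonneg (hβ.1 i) hs, fun j => ?_⟩
    have h1 : S.usage j (fun i => β i + s) = S.usage j β + s * S.rowSum j := by
      rw [← S.usage_const, ← S.usage_add]; rfl
    rw [h1]
    have h2 := le_mul_of_one_le_right hs (S.one_le_rowSum j)
    linarith [hβ.2 j, (abs_le.1 (h j)).2]
  have h1 := lpCost_le hfeas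
  have h2 : ∑ i, S.c i * (β i + s) = ∑ i, S.c i * β i + (∑ i, S.c i) * s := by
    simp only [mul_add, Finset.sum_add_distrib, Finset.sum_mul]
  have h3 : ∑ j, S.h j * q' j - ∑ j, S.h j * q j ≤ (∑ j, S.h j) * s := by
    rw [← Finset.sum_sub_distrib, Finset.sum_mul]
    refine Finset.sum_le_sum fun j _ => ?_
    rw [← mul_sub]
    exact mul_le_mul_of_nonneg_left (by linarith [(abs_le.1 (h j)).1]) (S.h_pos j).le
  rw [h2] at h1
  linarith

/-! ### The relaxed stochastic program in terms of nonnegative costs -/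

/-- A vector of natural numbers as a vector of reals. -/
def castVec (w : Fin m → ℕ) (i : Fin m) : ℝ := w i

variable (S)

/-- Component balance that results from the decisions `y` and the total demand `x`. -/
def Spec.balance (y : Fin n → ℝ) (x : Fin m → ℝ) (j : Fin n) : ℝ := S.usage j x - y j

/-- The value functions of the relaxed stochastic program when `ρ k` is the law of the stage-`k`
demand, normalized by the cost of the decisions already made and by the expected backlog cost of all
demand. After this normalization they are nonnegative. -/
def costToGo (ρ : ℕ → Measure (Fin m → ℕ)) : ℕ → (Fin n → ℝ) → (Fin m → ℝ) → ℝ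
  | 0, y, x => S.lpCost (S.balance y x)
  | k + 1, y, x => ⨅ v : S.Block (k + 1),
      ∫ w, costToGo ρ k (S.setBlock (k + 1) y v) (x + castVec w) ∂(ρ (k + 1))

variable {S} {ρ : ℕ → Measure (Fin m → ℕ)}

lemma costToGo_nonneg (k : ℕ) (y : Fin n → ℝ) (x : Fin m → ℝ) : 0 ≤ costToGo S ρ k y x := by
  induction k generalizing y x with
  | zero => exact Spec.lpCost_nonneg _
  | succ k ih => exact Real.iInf_nonneg fun v => integral_nonneg fun w => ih _ _

lemma costToGo_succ_le (k : ℕ) (y : Fin n → ℝ) (x : Fin m → ℝ) (v : S.Block (k + 1)) :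
    costToGo S ρ (k + 1) y x ≤
      ∫ w, costToGo S ρ k (S.setBlock (k + 1) y v) (x + castVec w) ∂(ρ (k + 1)) :=
  ciInf_le ⟨0, by rintro _ ⟨v, rfl⟩; exact integral_nonneg fun w => costToGo_nonneg _ _ _⟩ v

lemma Spec.setBlock_apply_of_eq {k : ℕ} (y : Fin n → ℝ) (v : S.Block k) {j : Fin n}
    (hj : S.grp j = k) : S.setBlock k y v j = v ⟨j, hj⟩ := by simp [Spec.setBlock, hj]

lemma Spec.setBlock_apply_of_ne {k : ℕ} (y : Fin n → ℝ) (v : S.Block k) {j : Fin n}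
    (hj : S.grp j ≠ k) : S.setBlock k y v j = y j := by simp [Spec.setBlock, hj]

lemma Spec.setBlock_self (k : ℕ) (y : Fin n → ℝ) : S.setBlock k y (fun j => y j) = y := by
  ext j; simp [Spec.setBlock]

/-- Only the decisions for components with longer lead times matter. -/
lemma costToGo_congr (k : ℕ) {y y' : Fin n → ℝ} (h : ∀ j, k < S.grp j → y j = y' j)
    (x : Fin m → ℝ) : costToGo S ρ k y x = costToGo S ρ k y' x := by
  induction k generalizing y y' x with
  | zero =>
    have : y = y' := funext fun j => h j (S.grp_mem j).1
    rw [this]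
  | succ k ih =>
    simp only [costToGo]
    refine iInf_congr fun v => integral_congr_ae (Eventually.of_forall fun w => ih (fun j hj => ?_) _)
    by_cases hjk : S.grp j = k + 1
    · rw [Spec.setBlock_apply_of_eq _ _ hjk, Spec.setBlock_apply_of_eq _ _ hjk]
    · rw [Spec.setBlock_apply_of_ne _ _ hjk, Spec.setBlock_apply_of_ne _ _ hjk]
      exact h j (by omega)

variable (S) in
/-- A common Lipschitz constant of the value functions. -/
def Spec.lipConst : ℝ := (∑ i, S.c i + ∑ j, S.h j) * (∑ j, S.rowSum j + 1)

lemma Spec.lipConst_nonneg : 0 ≤ S.lipConst := by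
  refine mul_nonneg (add_nonneg (Finset.sum_nonneg fun i _ => (S.c_pos i).le)
    (Finset.sum_nonneg fun j _ => (S.h_pos j).le)) (add_nonneg (Finset.sum_nonneg fun j _ => ?_)
    zero_le_one)
  linarith [S.one_le_rowSum j]

lemma integrable_castVec_sum {μ : Measure (Fin m → ℕ)}
    (h : ∀ i, Integrable (fun w : Fin m → ℕ => (w i : ℝ)) μ) :
    Integrable (fun w : Fin m → ℕ => ∑ i, (w i : ℝ)) μ :=
  integrable_finsetSum _ fun i _ => h i

lemma abs_castVec_le (w : Fin m → ℕ) (i : Fin m) : |castVec w i| ≤ ∑ i, (w i : ℝ) := by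
  rw [castVec, Nat.abs_cast]
  exact Finset.single_le_sum (f := fun i => (w i : ℝ)) (fun i _ => Nat.cast_nonneg _)
    (Finset.mem_univ i)

lemma integrable_of_le_add {μ : Measure (Fin m → ℕ)} [IsFiniteMeasure μ]
    (h : ∀ i, Integrable (fun w : Fin m → ℕ => (w i : ℝ)) μ) {f : (Fin m → ℕ) → ℝ} {a C : ℝ}
    (h0 : ∀ w, 0 ≤ f w) (hf : ∀ w, f w ≤ a + C * ∑ i, (w i : ℝ)) : Integrable f μ :=
  ((integrable_const a).add ((integrable_castVec_sum h).const_mul C)).mono'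
    Measurable.of_discrete.aestronglyMeasurable
    (Eventually.of_forall fun w => by rw [Real.norm_eq_abs, abs_of_nonneg (h0 w)]; exact hf w)

section Lipschitz

variable [∀ k, IsProbabilityMeasure (ρ k)]
  (hρ : ∀ k i, Integrable (fun w : Fin m → ℕ => (w i : ℝ)) (ρ k))
include hρ

/-- Lipschitz continuity of the value functions. -/
lemma costToGo_le_add (k : ℕ) {y y' : Fin n → ℝ} {x x' : Fin m → ℝ} {s : ℝ} (hs : 0 ≤ s)
    (hy : ∀ j, |y j - y' j| ≤ s) (hx : ∀ i, |x i - x' i| ≤ s) :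
    costToGo S ρ k y x ≤ costToGo S ρ k y' x' + S.lipConst * s := by
  induction k generalizing y y' x x' s with
  | zero =>
    have h1 : ∀ j, |S.balance y x j - S.balance y' x' j| ≤ (∑ j, S.rowSum j + 1) * s := by
      intro j
      have h2 : S.balance y x j - S.balance y' x' j =
          S.usage j (x - x') - (y j - y' j) := by
        rw [S.usage_sub, Spec.balance, Spec.balance]; ring
      have h3 : S.rowSum j ≤ ∑ j, S.rowSum j := Finset.single_le_sum
        (f := fun j => S.rowSum j) (fun j _ => by linarith [S.one_le_rowSum j]) (Finset.mem_univ j)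
      rw [h2]
      calc _ ≤ |S.usage j (x - x')| + |y j - y' j| := abs_sub _ _
        _ ≤ S.rowSum j * s + s := add_le_add (S.abs_usage_le j hx) (hy j)
        _ ≤ _ := by nlinarith
    have h4 := Spec.lpCost_le_add (S := S) (mul_nonneg (add_nonneg (Finset.sum_nonneg fun j _ => by
      linarith [S.one_le_rowSum j]) zero_le_one) hs) h1
    simp only [costToGo]
    rwa [Spec.lipConst, mul_assoc]
  | succ k ih =>
    have hint : ∀ (y : Fin n → ℝ) (x : Fin m → ℝ),
        Integrable (fun w => costToGo S ρ k y (x + castVec w)) (ρ (k + 1)) := fun y x =>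
      integrable_of_le_add (hρ (k + 1)) (fun w => costToGo_nonneg _ _ _) fun w =>
        ih (y' := y) (x' := x) (Finset.sum_nonneg fun i _ => Nat.cast_nonneg _) (fun j => by
          rw [sub_self, abs_zero]; exact Finset.sum_nonneg fun i _ => Nat.cast_nonneg _) fun i => by
          rw [Pi.add_apply, add_sub_cancel_left]; exact abs_castVec_le w i
    rw [← sub_le_iff_le_add]
    refine le_ciInf fun v => ?_
    rw [sub_le_iff_le_add]
    refine (costToGo_succ_le k y x v).trans ?_
    calc _ ≤ ∫ w, (costToGo S ρ k (S.setBlock (k + 1) y' v) (x' + castVec w) + S.lipConst * s)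
          ∂(ρ (k + 1)) := by
          refine integral_mono (hint _ _) ((hint _ _).add (integrable_const _)) fun w =>
            ih hs (fun j => ?_) fun i => ?_
          · by_cases hj : S.grp j = k + 1
            · rw [Spec.setBlock_apply_of_eq _ _ hj, Spec.setBlock_apply_of_eq _ _ hj, sub_self,
                abs_zero]
              exact hs
            · rw [Spec.setBlock_apply_of_ne _ _ hj, Spec.setBlock_apply_of_ne _ _ hj]
              exact hy j
          · rw [Pi.add_apply, Pi.add_apply, add_sub_add_right_eq_sub]
            exact hx i
      _ = _ := by
          rw [integral_add (hint _ _) (integrable_const _)]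
          simp

lemma integrable_costToGo (k l : ℕ) (y : Fin n → ℝ) (x : Fin m → ℝ) :
    Integrable (fun w => costToGo S ρ k y (x + castVec w)) (ρ l) :=
  integrable_of_le_add (hρ l) (fun w => costToGo_nonneg _ _ _) fun w =>
    costToGo_le_add hρ k (y' := y) (x' := x) (Finset.sum_nonneg fun i _ => Nat.cast_nonneg _)
      (fun j => by rw [sub_self, abs_zero]; exact Finset.sum_nonneg fun i _ => Nat.cast_nonneg _)
      fun i => by rw [Pi.add_apply, add_sub_cancel_left]; exact abs_castVec_le w i

lemma continuous_costToGo (k : ℕ) :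
    Continuous fun p : (Fin n → ℝ) × (Fin m → ℝ) => costToGo S ρ k p.1 p.2 := by
  have : LipschitzWith S.lipConst.toNNReal
      fun p : (Fin n → ℝ) × (Fin m → ℝ) => costToGo S ρ k p.1 p.2 := by
    refine LipschitzWith.of_le_add_mul _ fun p p' => ?_
    rw [Real.coe_toNNReal _ Spec.lipConst_nonneg]
    refine costToGo_le_add hρ k dist_nonneg (fun j => ?_) fun i => ?_
    · rw [← Real.dist_eq]
      exact (dist_le_pi_dist _ _ j).trans (le_max_left _ _)
    · rw [← Real.dist_eq]
      exact (dist_le_pi_dist _ _ i).trans (le_max_right _ _)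
  exact this.continuous

end Lipschitz

/-- Product quantities may be traded for the components that they need. -/
lemma costToGo_shift (k : ℕ) (y : Fin n → ℝ) (x α : Fin m → ℝ) :
    costToGo S ρ k (fun j => y j + S.usage j α) (x + α) = costToGo S ρ k y x := by
  induction k generalizing y x with
  | zero =>
    simp only [costToGo]
    congr 1
    ext j
    rw [Spec.balance, Spec.balance, S.usage_add]
    ring
  | succ k ih =>
    simp only [costToGo]
    let a : S.Block (k + 1) := fun j => S.usage j α
    rw [← (Equiv.addRight a).iInf_comp]
    refine iInf_congr fun v => integral_congr_ae (Eventually.of_forall fun w => ?_)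
    simp only [Equiv.coe_addRight]
    rw [← ih (S.setBlock (k + 1) y v) (x + castVec w), add_right_comm x (castVec w) α]
    congr 1
    ext j
    by_cases hj : S.grp j = k + 1
    · rw [Spec.setBlock_apply_of_eq _ _ hj, Spec.setBlock_apply_of_eq _ _ hj]
      rfl
    · rw [Spec.setBlock_apply_of_ne _ _ hj, Spec.setBlock_apply_of_ne _ _ hj]

end

/-! ### Normalization of the value functions -/

section

variable {m n : ℕ} {S : Spec m n} {Ω : Type*} [MeasurableSpace Ω] {P : Measure Ω}
  {ℓ : ℕ → ℝ} {D : ℝ → Ω → Fin m → ℕ} {ρ : ℕ → Measure (Fin m → ℕ)}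

variable (S) in
/-- Cost `∑_{l > k} hˡ · yˡ` of the decisions made before stage `k`. -/
def Spec.decidedCost (k : ℕ) (y : Fin n → ℝ) : ℝ := ∑ j, if k < S.grp j then S.h j * y j else 0

lemma Spec.decidedCost_zero (y : Fin n → ℝ) : S.decidedCost 0 y = ∑ j, S.h j * y j :=
  Finset.sum_congr rfl fun j _ => if_pos (S.grp_mem j).1

lemma Spec.decidedCost_of_le {k : ℕ} (hk : S.K ≤ k) (y : Fin n → ℝ) : S.decidedCost k y = 0 :=
  Finset.sum_eq_zero fun j _ => if_neg (by have := (S.grp_mem j).2; omega)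

lemma Spec.decidedCost_setBlock (k : ℕ) (y : Fin n → ℝ) (v : S.Block (k + 1)) :
    S.decidedCost k (S.setBlock (k + 1) y v) = S.decidedCost (k + 1) y +
      ∑ j : {j : Fin n // S.grp j = k + 1}, S.h j * v j := by
  have h1 : ∑ j : {j : Fin n // S.grp j = k + 1}, S.h j * v j =
      ∑ j, if S.grp j = k + 1 then S.h j * S.setBlock (k + 1) y v j else 0 := by
    rw [← Finset.sum_filter, ← Finset.sum_subtype_eq_sum_filter]
    rw [Finset.subtype_univ]
    exact Finset.sum_congr rfl fun j _ => by rw [Spec.setBlock_apply_of_eq _ _ j.2]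
  rw [h1, Spec.decidedCost, Spec.decidedCost, ← Finset.sum_add_distrib]
  refine Finset.sum_congr rfl fun j _ => ?_
  by_cases hj : S.grp j = k + 1
  · simp [hj]
  · rw [Spec.setBlock_apply_of_ne _ _ hj]
    simp only [hj, if_false, add_zero]
    congr 1
    exact propext ⟨fun h => by omega, fun h => by omega⟩

variable (S) in
/-- Expected backlog cost of the demand of the last `k` stages. -/
def Spec.demandCost (ρ : ℕ → Measure (Fin m → ℕ)) (k : ℕ) : ℝ :=
  ∑ l ∈ Finset.range k, ∑ i, S.b i * ∫ w, (w i : ℝ) ∂(ρ (l + 1))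

/-- `ρ k` is the law of the stage-`k` demand. -/
def IsStageLaw (S : Spec m n) (ℓ : ℕ → ℝ) (P : Measure Ω) (D : ℝ → Ω → Fin m → ℕ)
    (ρ : ℕ → Measure (Fin m → ℕ)) : Prop :=
  ∀ k < S.K, ∀ f : (Fin m → ℝ) → ℝ,
    ∫ ω, f (demand D (-ℓ (k + 1)) (-ℓ k) ω) ∂P = ∫ w, f (castVec w) ∂(ρ (k + 1))

section

variable [∀ k, IsProbabilityMeasure (ρ k)]

/-- If a value function differs from `g` by the normalization of stage `k`, then the stage objective
differs from the mean of `g` by the normalization of stage `k + 1`, whatever the decision `v`. -/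
lemma stageObj_eq (hlaw : IsStageLaw S ℓ P D ρ)
    (hρ : ∀ k i, Integrable (fun w : Fin m → ℕ => (w i : ℝ)) (ρ k)) {k : ℕ} (hk : k < S.K)
    {φ : (Fin n → ℝ) → (Fin m → ℝ) → ℝ} {y : Fin n → ℝ} {x : Fin m → ℝ} {v : S.Block (k + 1)}
    {g : (Fin m → ℕ) → ℝ} (hg : Integrable g (ρ (k + 1)))
    (hφ : ∀ w, φ (S.setBlock (k + 1) y v) (x + castVec w) = g w -
      (S.decidedCost k (S.setBlock (k + 1) y v) + ∑ i, S.b i * (x + castVec w) i +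
        S.demandCost ρ k)) :
    stageObj S ℓ P D φ (k + 1) y x v = ∫ w, g w ∂(ρ (k + 1)) -
      (S.decidedCost (k + 1) y + ∑ i, S.b i * x i + S.demandCost ρ (k + 1)) := by
  have h1 := hlaw k hk fun u => φ (S.setBlock (k + 1) y v) (x + u)
  simp only [stageObj, Nat.add_sub_cancel]
  rw [h1]
  have hb : Integrable (fun w : Fin m → ℕ => ∑ i, S.b i * (w i : ℝ)) (ρ (k + 1)) :=
    integrable_finsetSum _ fun i _ => (hρ (k + 1) i).const_mul _
  have hbv : ∫ w : Fin m → ℕ, ∑ i, S.b i * (w i : ℝ) ∂(ρ (k + 1)) =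
      ∑ i, S.b i * ∫ w, (w i : ℝ) ∂(ρ (k + 1)) := by
    rw [integral_finsetSum _ fun i _ => (hρ (k + 1) i).const_mul _]
    simp only [integral_const_mul]
  have h2 : ∀ w : Fin m → ℕ, φ (S.setBlock (k + 1) y v) (x + castVec w) =
      (g w - ∑ i, S.b i * (w i : ℝ)) - (S.decidedCost k (S.setBlock (k + 1) y v) +
        ∑ i, S.b i * x i + S.demandCost ρ k) := by
    intro w
    rw [hφ]
    simp only [Pi.add_apply, mul_add, Finset.sum_add_distrib, castVec]
    ring
  simp only [h2]
  have h3 : S.demandCost ρ (k + 1) = S.demandCost ρ k +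
      ∑ i, S.b i * ∫ w, (w i : ℝ) ∂(ρ (k + 1)) := Finset.sum_range_succ ..
  have h4 : Integrable (fun w : Fin m → ℕ => g w - ∑ i, S.b i * (w i : ℝ)) (ρ (k + 1)) := hg.sub hb
  rw [integral_sub h4 (integrable_const _), integral_sub hg hb, hbv,
    Spec.decidedCost_setBlock, h3]
  simp only [integral_const, probReal_univ, one_smul]
  ring

/-- Maximization over served demand `z` is minimization over backlogs `x - z`. -/
lemma isLUB_sum_c {T : Set (Fin m → ℝ)} {x : Fin m → ℝ} {q : ℝ}
    (h : IsGLB ((fun β : Fin m → ℝ => ∑ i, S.c i * β i) '' ((fun z => x - z) '' T)) q) :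
    IsLUB ((fun z : Fin m → ℝ => ∑ i, S.c i * z i) '' T) (∑ i, S.c i * x i - q) := by
  have key : ∀ z : Fin m → ℝ, ∑ i, S.c i * (x - z) i =
      ∑ i, S.c i * x i - ∑ i, S.c i * z i := fun z => by
    simp only [Pi.sub_apply, mul_sub, Finset.sum_sub_distrib]
  constructor
  · rintro _ ⟨z, hz, rfl⟩
    have := h.1 ⟨x - z, ⟨z, hz, rfl⟩, rfl⟩
    simp only [key] at this ⊢
    linarith
  · intro u hu
    have : ∑ i, S.c i * x i - u ≤ q := h.2 (by
      rintro _ ⟨_, ⟨z, hz, rfl⟩, rfl⟩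
      have := hu ⟨z, hz, rfl⟩
      simp only [key] at this ⊢
      linarith)
    linarith

omit [∀ k, IsProbabilityMeasure (ρ k)] in
lemma value_zero_eq (y : Fin n → ℝ) (x : Fin m → ℝ) :
    value S ℓ P D 0 y x = costToGo S ρ 0 y x - (S.decidedCost 0 y + ∑ i, S.b i * x i) := by
  have himg : (fun z => x - z) '' {z | z ≤ x ∧ ∀ j, S.usage j z ≤ y j} =
      S.backlogs (S.balance y x) := by
    ext β
    simp only [Set.mem_image, Set.mem_ofPred_eq, Spec.backlogs, Spec.balance]
    constructor
    · rintro ⟨z, ⟨hz, hzy⟩, rfl⟩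
      refine ⟨sub_nonneg.2 hz, fun j => ?_⟩
      rw [S.usage_sub]
      linarith [hzy j]
    · rintro ⟨hβ, hβy⟩
      refine ⟨x - β, ⟨sub_le_self _ hβ, fun j => ?_⟩, sub_sub_cancel x β⟩
      rw [S.usage_sub]
      linarith [hβy j]
  have hglb := isGLB_csInf ((Spec.backlogs_nonempty (S.balance y x)).image
    fun β : Fin m → ℝ => ∑ i, S.c i * β i) (Spec.bddBelow_backlogs (S := S) _)
  rw [← himg] at hglb
  have hlub := isLUB_sum_c hglb
  have hne : ((fun z : Fin m → ℝ => ∑ i, S.c i * z i) ''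
      {z | z ≤ x ∧ ∀ j, S.usage j z ≤ y j}).Nonempty := by
    have := Spec.backlogs_nonempty (S := S) (S.balance y x)
    rw [← himg] at this
    exact this.of_image.image _
  simp only [value, costToGo, Spec.lpCost]
  rw [hlub.csSup_eq hne, himg, Spec.decidedCost_zero, S.sum_c_mul x]
  simp only [Spec.balance, mul_sub, Finset.sum_sub_distrib]
  ring

/-- The value functions of the relaxed program differ from `costToGo` by the cost of the decisions
already made and the expected backlog cost of all demand. -/
lemma value_eq (hlaw : IsStageLaw S ℓ P D ρ)
    (hρ : ∀ k i, Integrable (fun w : Fin m → ℕ => (w i : ℝ)) (ρ k)) {k : ℕ} (hk : k ≤ S.K)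
    (y : Fin n → ℝ) (x : Fin m → ℝ) :
    value S ℓ P D k y x = costToGo S ρ k y x -
      (S.decidedCost k y + ∑ i, S.b i * x i + S.demandCost ρ k) := by
  induction k generalizing y x with
  | zero => rw [value_zero_eq (ρ := ρ), Spec.demandCost, Finset.sum_range_zero, add_zero]
  | succ k ih =>
    have h1 : ∀ v, stageObj S ℓ P D (value S ℓ P D k) (k + 1) y x v =
        ∫ w, costToGo S ρ k (S.setBlock (k + 1) y v) (x + castVec w) ∂(ρ (k + 1)) -
        (S.decidedCost (k + 1) y + ∑ i, S.b i * x i + S.demandCost ρ (k + 1)) := fun v =>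
      stageObj_eq hlaw hρ hk (integrable_costToGo hρ k (k + 1) _ x) fun w => ih (by omega) _ _
    simp only [value, costToGo]
    rw [funext h1, sInf_range, ciInf_sub]
    exact ⟨0, by rintro _ ⟨v, rfl⟩; exact integral_nonneg fun w => costToGo_nonneg _ _ _⟩

/-- Optimal decisions of the relaxed program attain the infimum in `costToGo`. -/
lemma IsStageOptimal.costToGo_eq (hlaw : IsStageLaw S ℓ P D ρ)
    (hρ : ∀ k i, Integrable (fun w : Fin m → ℕ => (w i : ℝ)) (ρ k)) {k : ℕ} (hk : k < S.K)
    {y : Fin n → ℝ} {x : Fin m → ℝ} {v : S.Block (k + 1)}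
    (hv : IsStageOptimal S ℓ P D (k + 1) y x v) :
    ∫ w, costToGo S ρ k (S.setBlock (k + 1) y v) (x + castVec w) ∂(ρ (k + 1)) =
      costToGo S ρ (k + 1) y x := by
  refine le_antisymm (le_ciInf fun v' => ?_) (costToGo_succ_le k y x v)
  have h1 : ∀ v, stageObj S ℓ P D (value S ℓ P D k) (k + 1) y x v =
      ∫ w, costToGo S ρ k (S.setBlock (k + 1) y v) (x + castVec w) ∂(ρ (k + 1)) -
      (S.decidedCost (k + 1) y + ∑ i, S.b i * x i + S.demandCost ρ (k + 1)) := fun v =>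
    stageObj_eq hlaw hρ hk (integrable_costToGo hρ k (k + 1) _ x) fun w =>
      value_eq hlaw hρ hk.le _ _
  have h2 := hv v'
  simp only [Nat.add_sub_cancel, h1] at h2
  linarith

end

end

/-! ### The nonnegativity constraints become irrelevant for large `α` -/

section

variable {m n : ℕ} {S : Spec m n} {Ω : Type*} [MeasurableSpace Ω] {P : Measure Ω}
  {ℓ : ℕ → ℝ} {D : ℝ → Ω → Fin m → ℕ} {ρ : ℕ → Measure (Fin m → ℕ)}

/-- The value functions of the program with nonnegativity constraints, normalized in the same way as
`costToGo`. -/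
def costToGoNonneg (S : Spec m n) (ℓ : ℕ → ℝ) (P : Measure Ω) (D : ℝ → Ω → Fin m → ℕ)
    (ρ : ℕ → Measure (Fin m → ℕ)) (k : ℕ) (y : Fin n → ℝ) (x : Fin m → ℝ) : ℝ :=
  valueNonneg S ℓ P D k y x + (S.decidedCost k y + ∑ i, S.b i * x i + S.demandCost ρ k)

lemma valueNonneg_congr (k : ℕ) {y y' : Fin n → ℝ} (h : ∀ j, k < S.grp j → y j = y' j)
    (x : Fin m → ℝ) : valueNonneg S ℓ P D k y x = valueNonneg S ℓ P D k y' x := by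
  induction k generalizing y y' x with
  | zero =>
    have : y = y' := funext fun j => h j (S.grp_mem j).1
    rw [this]
  | succ k ih =>
    have hobj : stageObj S ℓ P D (valueNonneg S ℓ P D k) (k + 1) y x =
        stageObj S ℓ P D (valueNonneg S ℓ P D k) (k + 1) y' x := by
      ext v
      simp only [stageObj]
      congr 1
      refine integral_congr_ae (Eventually.of_forall fun ω => ih (fun j hj => ?_) _)
      by_cases hjk : S.grp j = k + 1
      · rw [Spec.setBlock_apply_of_eq _ _ hjk, Spec.setBlock_apply_of_eq _ _ hjk]
      · rw [Spec.setBlock_apply_of_ne _ _ hjk, Spec.setBlock_apply_of_ne _ _ hjk]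
        exact h j (by omega)
    simp only [valueNonneg, hobj]

variable (S) in
/-- Decisions `y` after the addition of what is needed for `a` units of every product. -/
def Spec.raise (a : ℝ) (y : Fin n → ℝ) (j : Fin n) : ℝ := y j + a * S.rowSum j

lemma Spec.setBlock_raise (k : ℕ) (a : ℝ) (y : Fin n → ℝ) (v : S.Block k) :
    S.setBlock k (S.raise a y) (fun j => v j + a * S.rowSum j) = S.raise a (S.setBlock k y v) := by
  ext j
  by_cases hj : S.grp j = k
  · simp only [Spec.raise, Spec.setBlock_apply_of_eq _ _ hj]
  · simp only [Spec.raise, Spec.setBlock_apply_of_ne _ _ hj]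

lemma costToGo_raise (k : ℕ) (a : ℝ) (y : Fin n → ℝ) (x : Fin m → ℝ) :
    costToGo S ρ k (S.raise a y) (x + fun _ => a) = costToGo S ρ k y x := by
  rw [← costToGo_shift k y x fun _ => a]
  simp only [S.usage_const]
  rfl

/-- A feasible backlog that does not exceed demand bounds the constrained program. -/
lemma costToGoNonneg_zero_le {y : Fin n → ℝ} {x β : Fin m → ℝ}
    (hβ : β ∈ S.backlogs (S.balance y x)) (hβx : β ≤ x) :
    costToGoNonneg S ℓ P D ρ 0 y x ≤ ∑ i, S.c i * β i - ∑ j, S.h j * S.balance y x j := by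
  have hbdd : BddAbove ((fun z : Fin m → ℝ => ∑ i, S.c i * z i) ''
      {z | 0 ≤ z ∧ z ≤ x ∧ ∀ j, S.usage j z ≤ y j}) := by
    refine ⟨∑ i, S.c i * x i, ?_⟩
    rintro _ ⟨z, hz, rfl⟩
    exact Finset.sum_le_sum fun i _ => mul_le_mul_of_nonneg_left (hz.2.1 i) (S.c_pos i).le
  have hmem : x - β ∈ {z : Fin m → ℝ | 0 ≤ z ∧ z ≤ x ∧ ∀ j, S.usage j z ≤ y j} := by
    refine ⟨sub_nonneg.2 hβx, sub_le_self _ hβ.1, fun j => ?_⟩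
    rw [S.usage_sub]
    have := hβ.2 j
    rw [Spec.balance] at this
    linarith
  have h := le_csSup hbdd ⟨x - β, hmem, rfl⟩
  have h2 : ∑ i, S.c i * (x - β) i = ∑ i, S.c i * x i - ∑ i, S.c i * β i := by
    simp only [Pi.sub_apply, mul_sub, Finset.sum_sub_distrib]
  have h3 := S.sum_c_mul x
  simp only [h2] at h
  simp only [costToGoNonneg, valueNonneg, Spec.decidedCost_zero, Spec.demandCost,
    Finset.sum_range_zero, Spec.balance, mul_sub, Finset.sum_sub_distrib]
  linarith

lemma le_costToGoNonneg_zero {y : Fin n → ℝ} {x : Fin m → ℝ} (hy : ∀ j, 0 ≤ y j) (hx : 0 ≤ x) :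
    costToGo S ρ 0 y x ≤ costToGoNonneg S ℓ P D ρ 0 y x := by
  have hle : sSup ((fun z : Fin m → ℝ => ∑ i, S.c i * z i) ''
      {z | 0 ≤ z ∧ z ≤ x ∧ ∀ j, S.usage j z ≤ y j}) ≤
      ∑ i, S.b i * x i + ∑ j, S.h j * y j - S.lpCost (S.balance y x) := by
    refine csSup_le ⟨_, 0, ⟨le_rfl, hx, fun j => ?_⟩, rfl⟩ ?_
    · rw [S.usage_zero]; exact hy j
    · rintro _ ⟨z, hz, rfl⟩
      have hmem : x - z ∈ S.backlogs (S.balance y x) := by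
        refine ⟨sub_nonneg.2 hz.2.1, fun j => ?_⟩
        rw [S.usage_sub, Spec.balance]
        linarith [hz.2.2 j]
      have h1 := Spec.lpCost_le hmem
      have h2 : ∑ i, S.c i * (x - z) i = ∑ i, S.c i * x i - ∑ i, S.c i * z i := by
        simp only [Pi.sub_apply, mul_sub, Finset.sum_sub_distrib]
      have h3 := S.sum_c_mul x
      simp only [h2, Spec.balance, mul_sub, Finset.sum_sub_distrib] at h1 ⊢
      linarith
  simp only [costToGoNonneg, valueNonneg, Spec.decidedCost_zero, Spec.demandCost,
    Finset.sum_range_zero, costToGo]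
  linarith

/-- The decisions before stage `k` are nonnegative. -/
def Spec.DecidedNonneg (S : Spec m n) (k : ℕ) (y : Fin n → ℝ) : Prop :=
  ∀ j, k < S.grp j → 0 ≤ y j

lemma Spec.DecidedNonneg.setBlock {k : ℕ} {y : Fin n → ℝ} (hy : S.DecidedNonneg (k + 1) y)
    {v : S.Block (k + 1)} (hv : 0 ≤ v) : S.DecidedNonneg k (S.setBlock (k + 1) y v) := by
  intro j hj
  by_cases h : S.grp j = k + 1
  · rw [Spec.setBlock_apply_of_eq _ _ h]; exact hv _
  · rw [Spec.setBlock_apply_of_ne _ _ h]; exact hy j (by omega)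

/-- `costToGoNonneg` grows at most linearly, uniformly in the amount by which both decisions and
demand have been raised. -/
def LinearGrowth (S : Spec m n) (ℓ : ℕ → ℝ) (P : Measure Ω) (D : ℝ → Ω → Fin m → ℕ)
    (ρ : ℕ → Measure (Fin m → ℕ)) (k : ℕ) : Prop :=
  ∃ C C' : ℝ, 0 ≤ C ∧ ∀ (y : Fin n → ℝ) (x : Fin m → ℝ) (a : ℝ), 0 ≤ a →
    S.DecidedNonneg k (S.raise a y) → (0 ≤ x + fun _ => a) →
    costToGoNonneg S ℓ P D ρ k (S.raise a y) (x + fun _ => a) ≤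
      C * (∑ j, |y j| + ∑ i, |x i|) + C'

lemma linearGrowth_zero : LinearGrowth S ℓ P D ρ 0 := by
  refine ⟨∑ i, S.c i + ∑ i, S.b i + ∑ j, S.h j, 0, ?_, ?_⟩
  · exact add_nonneg (add_nonneg (Finset.sum_nonneg fun i _ => (S.c_pos i).le)
      (Finset.sum_nonneg fun i _ => (S.b_pos i).le)) (Finset.sum_nonneg fun j _ => (S.h_pos j).le)
  intro y x a ha hy hx
  set T := ∑ j, |y j| + ∑ i, |x i| with hT
  have hyT : ∀ j, |y j| ≤ T := fun j =>
    (Finset.single_le_sum (f := fun j => |y j|) (fun j _ => abs_nonneg _) (Finset.mem_univ j)).trans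
      (le_add_of_nonneg_right (Finset.sum_nonneg fun i _ => abs_nonneg _))
  have hxT : ∀ i, |x i| ≤ T := fun i =>
    (Finset.single_le_sum (f := fun i => |x i|) (fun j _ => abs_nonneg _) (Finset.mem_univ i)).trans
      (le_add_of_nonneg_left (Finset.sum_nonneg fun i _ => abs_nonneg _))
  have hT0 : 0 ≤ T := add_nonneg (Finset.sum_nonneg fun i _ => abs_nonneg _)
    (Finset.sum_nonneg fun i _ => abs_nonneg _)
  -- serving `-s` units of every product, as far as the raise by `a` permits, is feasible
  set s := min a T with hs
  have hs0 : 0 ≤ s := le_min ha hT0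
  let β : Fin m → ℝ := x + fun _ => s
  have hbal : ∀ j, S.balance (S.raise a y) (x + fun _ => a) j = S.usage j x - y j := by
    intro j
    rw [Spec.balance, S.usage_add, S.usage_const, Spec.raise]; ring
  have hβ : β ∈ S.backlogs (S.balance (S.raise a y) (x + fun _ => a)) := by
    refine ⟨fun i => ?_, fun j => ?_⟩
    · have h1 := hx i
      have h2 := neg_le_of_abs_le (hxT i)
      simp only [Pi.zero_apply, Pi.add_apply, β] at h1 ⊢
      rcases min_choice a T with h | h <;> rw [hs, h] <;> linarith
    · rw [hbal]
      simp only [β]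
      rw [S.usage_add, S.usage_const]
      have h1 := hy j (S.grp_mem j).1
      have h2 := neg_le_of_abs_le (hyT j)
      rw [Spec.raise] at h1
      have h3 := le_mul_of_one_le_right hT0 (S.one_le_rowSum j)
      rcases min_choice a T with h | h <;> rw [hs, h] <;> linarith
  have h1 := costToGoNonneg_zero_le (ℓ := ℓ) (P := P) (D := D) (ρ := ρ) hβ
    (add_le_add_right (fun _ => min_le_left a T : (fun _ : Fin m => s) ≤ fun _ => a) x)
  refine h1.trans ?_
  simp only [hbal]
  have h2 : ∑ i, S.c i * β i = ∑ i, S.b i * x i + ∑ j, S.h j * S.usage j x + (∑ i, S.c i) * s := by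
    rw [← S.sum_c_mul]
    simp only [β, Pi.add_apply, mul_add, Finset.sum_add_distrib, Finset.sum_mul]
  have h3 : ∑ i, S.b i * x i ≤ (∑ i, S.b i) * T := by
    rw [Finset.sum_mul]
    exact Finset.sum_le_sum fun i _ =>
      mul_le_mul_of_nonneg_left ((le_abs_self _).trans (hxT i)) (S.b_pos i).le
  have h4 : ∑ j, S.h j * y j ≤ (∑ j, S.h j) * T := by
    rw [Finset.sum_mul]
    exact Finset.sum_le_sum fun j _ =>
      mul_le_mul_of_nonneg_left ((le_abs_self _).trans (hyT j)) (S.h_pos j).le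
  have h5 : (∑ i, S.c i) * s ≤ (∑ i, S.c i) * T :=
    mul_le_mul_of_nonneg_left (min_le_right a T) (Finset.sum_nonneg fun i _ => (S.c_pos i).le)
  simp only [mul_sub, Finset.sum_sub_distrib]
  rw [h2]
  linarith

section

variable [∀ k, IsProbabilityMeasure (ρ k)]

/-- The constraints can only increase costs. -/
def DominatesRelaxation (S : Spec m n) (ℓ : ℕ → ℝ) (P : Measure Ω) (D : ℝ → Ω → Fin m → ℕ)
    (ρ : ℕ → Measure (Fin m → ℕ)) (k : ℕ) : Prop :=
  ∀ (y : Fin n → ℝ) (x : Fin m → ℝ), S.DecidedNonneg k y → 0 ≤ x →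
    costToGo S ρ k y x ≤ costToGoNonneg S ℓ P D ρ k y x

lemma castVec_nonneg (w : Fin m → ℕ) : 0 ≤ castVec w := fun _ => Nat.cast_nonneg _

lemma sum_abs_add_castVec_le (x : Fin m → ℝ) (w : Fin m → ℕ) :
    ∑ i, |(x + castVec w) i| ≤ ∑ i, |x i| + ∑ i, (w i : ℝ) := by
  rw [← Finset.sum_add_distrib]
  refine Finset.sum_le_sum fun i _ => (abs_add_le _ _).trans ?_
  rw [castVec, Nat.abs_cast]

omit [∀ k, IsProbabilityMeasure (ρ k)] in
/-- The bound of `LinearGrowth` as a function of the next demand. -/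
lemma LinearGrowth.next {k : ℕ} (hG : LinearGrowth S ℓ P D ρ k) :
    ∃ C C' : ℝ, 0 ≤ C ∧ ∀ (y : Fin n → ℝ) (x : Fin m → ℝ) (a : ℝ), 0 ≤ a →
      S.DecidedNonneg k (S.raise a y) → (0 ≤ x + fun _ => a) → ∀ w,
      costToGoNonneg S ℓ P D ρ k (S.raise a y) ((x + fun _ => a) + castVec w) ≤
        (C * (∑ j, |y j| + ∑ i, |x i|) + C') + C * ∑ i, (w i : ℝ) := by
  obtain ⟨C, C', hC, h⟩ := hG
  refine ⟨C, C', hC, fun y x a ha hy hx w => ?_⟩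
  have h1 := h y (x + castVec w) a ha hy (by
    rw [add_right_comm]; exact add_nonneg hx (castVec_nonneg w))
  rw [add_right_comm] at h1
  refine h1.trans ?_
  have := mul_le_mul_of_nonneg_left (sum_abs_add_castVec_le x w) hC
  linarith

lemma integrable_costToGoNonneg
    (hρ : ∀ k i, Integrable (fun w : Fin m → ℕ => (w i : ℝ)) (ρ k)) {k : ℕ}
    (hG : LinearGrowth S ℓ P D ρ k) (hR : DominatesRelaxation S ℓ P D ρ k)
    {y : Fin n → ℝ} (hy : S.DecidedNonneg k y) {x : Fin m → ℝ} (hx : 0 ≤ x) (l : ℕ) :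
    Integrable (fun w => costToGoNonneg S ℓ P D ρ k y (x + castVec w)) (ρ l) := by
  obtain ⟨C, C', hC, h⟩ := hG.next
  have h0 : S.raise 0 y = y := funext fun j => by simp [Spec.raise]
  have hx0 : (x + fun _ => (0 : ℝ)) = x := add_zero x
  refine integrable_of_le_add (a := C * (∑ j, |y j| + ∑ i, |x i|) + C') (C := C) (hρ l) (fun w => ?_)
    fun w => ?_
  · exact (costToGo_nonneg k y _).trans (hR y _ hy (add_nonneg hx (castVec_nonneg w)))
  · have := h y x 0 le_rfl (by rwa [h0]) (by rwa [hx0]) w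
    rwa [h0, hx0] at this

/-- The recursion for the program with constraints. -/
lemma costToGoNonneg_succ (hlaw : IsStageLaw S ℓ P D ρ)
    (hρ : ∀ k i, Integrable (fun w : Fin m → ℕ => (w i : ℝ)) (ρ k)) {k : ℕ} (hk : k < S.K)
    (hG : LinearGrowth S ℓ P D ρ k) (hR : DominatesRelaxation S ℓ P D ρ k)
    {y : Fin n → ℝ} (hy : S.DecidedNonneg (k + 1) y) {x : Fin m → ℝ} (hx : 0 ≤ x) :
    IsGLB ((fun v => ∫ w, costToGoNonneg S ℓ P D ρ k (S.setBlock (k + 1) y v) (x + castVec w)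
      ∂(ρ (k + 1))) '' {v | 0 ≤ v}) (costToGoNonneg S ℓ P D ρ (k + 1) y x) := by
  set c₀ := S.decidedCost (k + 1) y + ∑ i, S.b i * x i + S.demandCost ρ (k + 1) with hc₀
  have h1 : ∀ v : S.Block (k + 1), 0 ≤ v →
      stageObj S ℓ P D (valueNonneg S ℓ P D k) (k + 1) y x v =
        ∫ w, costToGoNonneg S ℓ P D ρ k (S.setBlock (k + 1) y v) (x + castVec w)
          ∂(ρ (k + 1)) - c₀ := fun v hv =>
    stageObj_eq hlaw hρ hk (integrable_costToGoNonneg hρ hG hR (hy.setBlock hv) hx (k + 1))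
      fun w => by rw [costToGoNonneg]; ring
  have hnn : ∀ v : S.Block (k + 1), 0 ≤ v →
      0 ≤ ∫ w, costToGoNonneg S ℓ P D ρ k (S.setBlock (k + 1) y v) (x + castVec w)
          ∂(ρ (k + 1)) := fun v hv => integral_nonneg fun w =>
    (costToGo_nonneg k _ _).trans (hR _ _ (hy.setBlock hv) (add_nonneg hx (castVec_nonneg w)))
  have hglb := isGLB_csInf (s := stageObj S ℓ P D (valueNonneg S ℓ P D k) (k + 1) y x '' {v | 0 ≤ v})
    ⟨_, 0, le_refl (0 : S.Block (k + 1)), rfl⟩ ⟨-c₀, by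
      rintro _ ⟨v, hv, rfl⟩
      rw [h1 v hv]
      linarith [hnn v hv]⟩
  have hval : costToGoNonneg S ℓ P D ρ (k + 1) y x =
      sInf (stageObj S ℓ P D (valueNonneg S ℓ P D k) (k + 1) y x '' {v | 0 ≤ v}) + c₀ := rfl
  rw [hval]
  constructor
  · rintro _ ⟨v, hv, rfl⟩
    have := hglb.1 ⟨v, hv, rfl⟩
    rw [h1 v hv] at this
    simp only
    linarith
  · intro r hr
    have : r - c₀ ≤ _ := hglb.2 (by
      rintro _ ⟨v, hv, rfl⟩
      rw [h1 v hv]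
      exact sub_le_sub_right (hr ⟨v, hv, rfl⟩) _)
    linarith

lemma LinearGrowth.succ (hlaw : IsStageLaw S ℓ P D ρ)
    (hρ : ∀ k i, Integrable (fun w : Fin m → ℕ => (w i : ℝ)) (ρ k)) {k : ℕ} (hk : k < S.K)
    (hG : LinearGrowth S ℓ P D ρ k) (hR : DominatesRelaxation S ℓ P D ρ k) :
    LinearGrowth S ℓ P D ρ (k + 1) := by
  obtain ⟨C, C', hC, h⟩ := hG.next
  refine ⟨C, C' + C * ∫ w, ∑ i, (w i : ℝ) ∂(ρ (k + 1)), hC, fun y x a ha hy hx => ?_⟩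
  have hv : (0 : S.Block (k + 1)) ≤ fun j => (0 : S.Block (k + 1)) j + a * S.rowSum j := fun j => by
    have := S.one_le_rowSum j
    simp only [Pi.zero_apply, zero_add]
    positivity
  have hy' : S.DecidedNonneg k (S.raise a (S.setBlock (k + 1) y 0)) := by
    rw [← Spec.setBlock_raise]; exact hy.setBlock hv
  have h1 := (costToGoNonneg_succ hlaw hρ hk hG hR hy hx).1 ⟨_, hv, rfl⟩
  refine h1.trans ?_
  simp only [Spec.setBlock_raise]
  have hint := integrable_costToGoNonneg hρ hG hR hy' hx (k + 1)
  refine (integral_mono hint ((integrable_const _).add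
    ((integrable_castVec_sum (hρ (k + 1))).const_mul C)) (h _ x a ha hy' hx)).trans ?_
  rw [integral_add' (integrable_const _) ((integrable_castVec_sum (hρ (k + 1))).const_mul C),
    integral_const_mul]
  simp only [integral_const, probReal_univ, one_smul]
  have h2 : ∑ j, |S.setBlock (k + 1) y 0 j| ≤ ∑ j, |y j| := Finset.sum_le_sum fun j _ => by
    by_cases hj : S.grp j = k + 1
    · rw [Spec.setBlock_apply_of_eq _ _ hj]; simp
    · rw [Spec.setBlock_apply_of_ne _ _ hj]
  have := mul_le_mul_of_nonneg_left h2 hC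
  linarith

lemma DominatesRelaxation.succ (hlaw : IsStageLaw S ℓ P D ρ)
    (hρ : ∀ k i, Integrable (fun w : Fin m → ℕ => (w i : ℝ)) (ρ k)) {k : ℕ} (hk : k < S.K)
    (hG : LinearGrowth S ℓ P D ρ k) (hR : DominatesRelaxation S ℓ P D ρ k) :
    DominatesRelaxation S ℓ P D ρ (k + 1) := by
  intro y x hy hx
  refine (costToGoNonneg_succ hlaw hρ hk hG hR hy hx).2 ?_
  rintro _ ⟨v, hv, rfl⟩
  refine (costToGo_succ_le k y x v).trans (integral_mono (integrable_costToGo hρ k (k + 1) _ x)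
    (integrable_costToGoNonneg hρ hG hR (hy.setBlock hv) hx (k + 1)) fun w => ?_)
  exact hR _ _ (hy.setBlock hv) (add_nonneg hx (castVec_nonneg w))

lemma linearGrowth_and_dominatesRelaxation (hlaw : IsStageLaw S ℓ P D ρ)
    (hρ : ∀ k i, Integrable (fun w : Fin m → ℕ => (w i : ℝ)) (ρ k)) {k : ℕ} (hk : k ≤ S.K) :
    LinearGrowth S ℓ P D ρ k ∧ DominatesRelaxation S ℓ P D ρ k := by
  induction k with
  | zero => exact ⟨linearGrowth_zero, fun y x hy hx =>
      le_costToGoNonneg_zero (fun j => hy j (S.grp_mem j).1) hx⟩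
  | succ k ih =>
    obtain ⟨hG, hR⟩ := ih (by omega)
    exact ⟨hG.succ hlaw hρ hk hR, hR.succ hlaw hρ hk hG⟩

lemma eventually_raise_nonneg (y : Fin n → ℝ) : ∀ᶠ a in atTop, ∀ j, 0 ≤ S.raise a y j := by
  refine eventually_all.2 fun j => (eventually_ge_atTop |y j|).mono fun a ha => ?_
  have h1 := le_mul_of_one_le_right ((abs_nonneg _).trans ha) (S.one_le_rowSum j)
  have := neg_abs_le (y j)
  rw [Spec.raise]
  linarith

lemma eventually_add_nonneg (x : Fin m → ℝ) : ∀ᶠ a : ℝ in atTop, 0 ≤ x + fun _ => a := by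
  have : ∀ᶠ a : ℝ in atTop, ∀ i, 0 ≤ x i + a :=
    eventually_all.2 fun i => (eventually_ge_atTop (-x i)).mono fun a ha => by linarith
  exact this

/-- The constraints lose their effect as decisions and demand are raised. -/
lemma tendsto_costToGoNonneg (hlaw : IsStageLaw S ℓ P D ρ)
    (hρ : ∀ k i, Integrable (fun w : Fin m → ℕ => (w i : ℝ)) (ρ k)) {k : ℕ} (hk : k ≤ S.K)
    (y : Fin n → ℝ) (x : Fin m → ℝ) :
    Tendsto (fun a : ℝ => costToGoNonneg S ℓ P D ρ k (S.raise a y) (x + fun _ => a)) atTop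
      (𝓝 (costToGo S ρ k y x)) := by
  -- the lower bound is `DominatesRelaxation`
  suffices hup : ∀ ε > 0, ∀ᶠ a in atTop,
      costToGoNonneg S ℓ P D ρ k (S.raise a y) (x + fun _ => a) < costToGo S ρ k y x + ε by
    obtain ⟨-, hR⟩ := linearGrowth_and_dominatesRelaxation hlaw hρ hk
    refine tendsto_order.2 ⟨fun r hr => ?_, fun r hr => ?_⟩
    · filter_upwards [eventually_raise_nonneg (S := S) y, eventually_add_nonneg x] with a hy hx
      have := hR _ _ (fun j _ => hy j) hx
      rw [costToGo_raise] at this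
      linarith
    · filter_upwards [hup (r - costToGo S ρ k y x) (by linarith)] with a ha
      linarith
  intro ε hε
  induction k generalizing y x ε with
  | zero =>
    obtain ⟨β, hβ, hβε⟩ := Spec.exists_lt_lpCost_add (S := S) (S.balance y x) hε
    filter_upwards [eventually_add_nonneg (x - β)] with a ha
    have hbal : S.balance (S.raise a y) (x + fun _ => a) = S.balance y x := by
      ext j
      rw [Spec.balance, Spec.balance, S.usage_add, S.usage_const, Spec.raise]
      ring
    have hβx : β ≤ x + fun _ => a := fun i => by
      have := ha i
      simp only [Pi.zero_apply, Pi.add_apply, Pi.sub_apply] at this ⊢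
      linarith
    have h1 := costToGoNonneg_zero_le (ℓ := ℓ) (P := P) (D := D) (ρ := ρ)
      (y := S.raise a y) (x := x + fun _ => a) (β := β) (by rwa [hbal]) hβx
    rw [hbal] at h1
    exact h1.trans_lt hβε
  | succ k ih =>
    obtain ⟨hG, hR⟩ := linearGrowth_and_dominatesRelaxation hlaw hρ (show k ≤ S.K by omega)
    obtain ⟨v, hv⟩ : ∃ v : S.Block (k + 1),
        ∫ w, costToGo S ρ k (S.setBlock (k + 1) y v) (x + castVec w) ∂(ρ (k + 1)) <
          costToGo S ρ (k + 1) y x + ε :=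
      exists_lt_of_ciInf_lt (lt_add_of_pos_right _ hε)
    set y' := S.setBlock (k + 1) y v with hy'
    obtain ⟨C, C', hC, hbound⟩ := hG.next
    have hpt : ∀ w : Fin m → ℕ, Tendsto (fun a : ℝ => costToGoNonneg S ℓ P D ρ k (S.raise a y')
        ((x + fun _ => a) + castVec w)) atTop (𝓝 (costToGo S ρ k y' (x + castVec w))) := by
      intro w
      refine tendsto_order.2 ⟨fun r hr => ?_, fun r hr => ?_⟩
      · filter_upwards [eventually_raise_nonneg (S := S) y', eventually_add_nonneg x] with a hya hxa
        have := hR _ _ (fun j _ => hya j) (add_nonneg hxa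
          (castVec_nonneg w))
        rw [add_right_comm, costToGo_raise] at this
        rw [add_right_comm]
        linarith
      · filter_upwards [ih (by omega) y' (x + castVec w) (r - costToGo S ρ k y' (x + castVec w))
          (by linarith)] with a ha
        rw [add_right_comm]
        linarith
    have hlim := tendsto_integral_filter_of_dominated_convergence (μ := ρ (k + 1))
      (F := fun a w => costToGoNonneg S ℓ P D ρ k (S.raise a y') ((x + fun _ => a) + castVec w))
      (fun w => (C * (∑ j, |y' j| + ∑ i, |x i|) + C') + C * ∑ i, (w i : ℝ))
      (Eventually.of_forall fun a => Measurable.of_discrete.aestronglyMeasurable) (by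
        filter_upwards [eventually_ge_atTop 0, eventually_raise_nonneg (S := S) y',
          eventually_add_nonneg x] with a ha hya hxa
        refine Eventually.of_forall fun w => ?_
        have hw := add_nonneg hxa (castVec_nonneg w)
        rw [Real.norm_eq_abs, abs_of_nonneg ((costToGo_nonneg k _ _).trans
          (hR _ _ (fun j _ => hya j) hw))]
        exact hbound y' x a ha (fun j _ => hya j) hxa w)
      ((integrable_const _).add ((integrable_castVec_sum (hρ (k + 1))).const_mul C))
      (Eventually.of_forall hpt)
    filter_upwards [hlim.eventually (eventually_lt_nhds hv), eventually_raise_nonneg (S := S) y,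
      eventually_raise_nonneg (S := S) y', eventually_add_nonneg x] with a ha hya hya' hxa
    have hva : (0 : S.Block (k + 1)) ≤ fun j => v j + a * S.rowSum j := fun j => by
      have h1 := hya' j
      rw [Spec.raise, hy', Spec.setBlock_apply_of_eq _ _ j.2] at h1
      exact h1
    have h1 := (costToGoNonneg_succ hlaw hρ hk hG hR (fun j _ => hya j) hxa).1 ⟨_, hva, rfl⟩
    simp only [Spec.setBlock_raise] at h1
    exact h1.trans_lt ha

/-- The lower bound on costs is the value of the relaxed program. -/
lemma lowerBound_eq (hlaw : IsStageLaw S ℓ P D ρ)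
    (hρ : ∀ k i, Integrable (fun w : Fin m → ℕ => (w i : ℝ)) (ρ k))
    (hdem : ∑ i, S.b i * ∫ ω, demand D (-ℓ S.K) 0 ω i ∂P = S.demandCost ρ S.K) :
    lowerBound S ℓ P D = costToGo S ρ S.K 0 0 := by
  obtain ⟨-, hR⟩ := linearGrowth_and_dominatesRelaxation hlaw hρ (le_refl S.K)
  have hU : ∀ (y : Fin n → ℝ) (α : Fin m → ℝ), costToGoNonneg S ℓ P D ρ S.K y α =
      ∑ i, S.b i * α i + valueNonneg S ℓ P D S.K y α + S.demandCost ρ S.K := fun y α => by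
    rw [costToGoNonneg, Spec.decidedCost_of_le le_rfl]
    ring
  have hbound : ∀ α : Fin m → ℝ, 0 ≤ α → costToGo S ρ S.K 0 0 - S.demandCost ρ S.K ≤
      ∑ i, S.b i * α i + valueNonneg S ℓ P D S.K 0 α := by
    intro α hα
    have h1 := hR 0 α (fun j _ => le_rfl) hα
    have h2 := costToGo_shift (S := S) (ρ := ρ) S.K 0 0 α
    rw [zero_add, costToGo_congr S.K (y' := 0) fun j hj => absurd (S.grp_mem j).2 (by omega)] at h2
    rw [h2, hU] at h1
    linarith
  rw [lowerBound, hdem]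
  have hglb : sInf ((fun α : Fin m → ℝ => ∑ i, S.b i * α i + valueNonneg S ℓ P D S.K 0 α) ''
      {α | 0 ≤ α}) = costToGo S ρ S.K 0 0 - S.demandCost ρ S.K := by
    have hbdd : BddBelow ((fun α : Fin m → ℝ => ∑ i, S.b i * α i + valueNonneg S ℓ P D S.K 0 α) ''
        {α | 0 ≤ α}) := ⟨_, by rintro _ ⟨α, hα, rfl⟩; exact hbound α hα⟩
    refine le_antisymm (le_of_forall_pos_lt_add fun ε hε => ?_)
      (le_csInf ⟨_, 0, le_refl (0 : Fin m → ℝ), rfl⟩ (by rintro _ ⟨α, hα, rfl⟩; exact hbound α hα))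
    have hlim := tendsto_costToGoNonneg hlaw hρ (le_refl S.K) 0 0
    obtain ⟨a, ha, hxa⟩ := ((hlim.eventually (eventually_lt_nhds
      (lt_add_of_pos_right _ hε))).and (eventually_ge_atTop 0)).exists
    have hcongr : costToGoNonneg S ℓ P D ρ S.K (S.raise a 0) (0 + fun _ => a) =
        costToGoNonneg S ℓ P D ρ S.K 0 (0 + fun _ => a) := by
      simp only [costToGoNonneg, Spec.decidedCost_of_le le_rfl]
      rw [valueNonneg_congr S.K (y' := 0) fun j hj => absurd (S.grp_mem j).2 (by omega)]
    rw [hcongr, hU, zero_add] at ha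
    have := csInf_le hbdd ⟨fun _ => a, fun _ => hxa, rfl⟩
    simp only at this
    linarith
  rw [hglb]
  ring

end

end

/-! ### Conditioning on the history, stage by stage -/

section

variable {m n : ℕ} {S : Spec m n} {Ω : Type*} [MeasurableSpace Ω] {P : Measure Ω}
  [IsProbabilityMeasure P] {ℓ : ℕ → ℝ} {L : ℝ} {D : ℝ → Ω → Fin m → ℕ} {lam : ℝ≥0}
  {ν : Measure (Fin m → ℕ)} [IsProbabilityMeasure ν]

/-- The law of the stage-`k` demand. -/
def stageLaw (lam : ℝ≥0) (ν : Measure (Fin m → ℕ)) (ℓ : ℕ → ℝ) (k : ℕ) : Measure (Fin m → ℕ) :=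
  cpLaw lam ν (ℓ k - ℓ (k - 1))

instance (k : ℕ) : IsProbabilityMeasure (stageLaw lam ν ℓ k) := by
  unfold stageLaw; infer_instance

lemma IsLeadTimes.mono {K : ℕ} (hℓ : IsLeadTimes K ℓ L) {k l : ℕ} (hkl : k ≤ l) (hl : l ≤ K) :
    ℓ k ≤ ℓ l :=
  hℓ.strictMono.monotoneOn (Set.mem_Iic.2 (hkl.trans hl)) (Set.mem_Iic.2 hl) hkl

omit [IsProbabilityMeasure P] [IsProbabilityMeasure ν] in
lemma IsCompoundPoisson.demand_eq {t₀ : ℝ} (hD : IsCompoundPoisson P t₀ lam ν D) {s t : ℝ}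
    (hst : s ≤ t) (ω : Ω) : demand D s t ω = castVec (inc D s t ω) := by
  ext i
  rw [demand, castVec, inc, Nat.cast_sub (hD.mono ω hst i)]

omit [MeasurableSpace Ω] in
lemma demand_add_demand (r s t : ℝ) (ω : Ω) :
    demand D r s ω + demand D s t ω = demand D r t ω := by
  ext i
  simp [demand]

omit [MeasurableSpace Ω] in
lemma measurable_prodMk_demand {G : MeasurableSpace Ω} {y : Ω → Fin n → ℝ}
    (hy : ∀ j, Measurable fun ω => y ω j) {s t : ℝ} (hs : Measurable (D s)) (ht : Measurable (D t)) :
    Measurable fun ω => (y ω, demand D s t ω) := by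
  refine Measurable.prodMk (measurable_pi_iff.2 hy) (measurable_pi_iff.2 fun i => ?_)
  have hc : Measurable fun w : Fin m → ℕ => (w i : ℝ) := Measurable.of_discrete
  exact (hc.comp ht).sub (hc.comp hs)

lemma isStageLaw_stageLaw (hℓ : IsLeadTimes S.K ℓ L) (hD : IsCompoundPoisson P (-L) lam ν D) :
    IsStageLaw S ℓ P D (stageLaw lam ν ℓ) := by
  intro k hk f
  have h1 : -ℓ (k + 1) ≤ -ℓ k := neg_le_neg (hℓ.mono (Nat.le_succ k) hk)
  have h2 : -L ≤ -ℓ (k + 1) := neg_le_neg (hℓ.longest ▸ hℓ.mono hk le_rfl)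
  have h3 := hD.map_inc h2 h1
  rw [show -ℓ k - -ℓ (k + 1) = ℓ (k + 1) - ℓ (k + 1 - 1) by rw [Nat.add_sub_cancel]; ring] at h3
  rw [stageLaw, ← h3, integral_map (hD.measurable_inc _ _).aemeasurable
    Measurable.of_discrete.aestronglyMeasurable]
  simp only [hD.demand_eq h1]

lemma sum_integral_demand_eq (hν : ∀ i, Integrable (fun s : Fin m → ℕ => (s i : ℝ)) ν)
    (hℓ : IsLeadTimes S.K ℓ L) (hD : IsCompoundPoisson P (-L) lam ν D) {k : ℕ} (hk : k ≤ S.K) :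
    (∀ i, Integrable (fun ω => demand D (-ℓ k) 0 ω i) P) ∧
    ∑ i, S.b i * ∫ ω, demand D (-ℓ k) 0 ω i ∂P = S.demandCost (stageLaw lam ν ℓ) k := by
  induction k with
  | zero =>
    have : ∀ ω i, demand D (-ℓ 0) 0 ω i = 0 := fun ω i => by rw [hℓ.zero, neg_zero]; simp [demand]
    simp [this, Spec.demandCost]
  | succ k ih =>
    obtain ⟨hint, hval⟩ := ih (by omega)
    have h1 : -ℓ (k + 1) ≤ -ℓ k := neg_le_neg (hℓ.mono (Nat.le_succ k) hk)
    have h2 : -L ≤ -ℓ (k + 1) := neg_le_neg (hℓ.longest ▸ hℓ.mono hk le_rfl)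
    have h3 := hD.map_inc h2 h1
    rw [show -ℓ k - -ℓ (k + 1) = ℓ (k + 1) - ℓ (k + 1 - 1) by rw [Nat.add_sub_cancel]; ring] at h3
    have hint' : ∀ i, Integrable (fun ω => demand D (-ℓ (k + 1)) (-ℓ k) ω i) P := fun i => by
      have h4 := integrable_cpLaw (lam := lam) hν (ℓ (k + 1) - ℓ (k + 1 - 1)) i
      rw [← h3, integrable_map_measure Measurable.of_discrete.aestronglyMeasurable
        (hD.measurable_inc _ _).aemeasurable] at h4
      simp only [hD.demand_eq h1]
      exact h4
    have hsplit : ∀ ω i, demand D (-ℓ (k + 1)) 0 ω i =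
        demand D (-ℓ (k + 1)) (-ℓ k) ω i + demand D (-ℓ k) 0 ω i := fun ω i => by
      rw [← demand_add_demand _ (-ℓ k)]; rfl
    refine ⟨fun i => ?_, ?_⟩
    · simp only [hsplit]
      exact (hint' i).add (hint i)
    · have h5 : S.demandCost (stageLaw lam ν ℓ) (k + 1) = S.demandCost (stageLaw lam ν ℓ) k +
        ∑ i, S.b i * ∫ w, (w i : ℝ) ∂(stageLaw lam ν ℓ (k + 1)) := Finset.sum_range_succ ..
      rw [h5, ← hval, ← Finset.sum_add_distrib]
      refine Finset.sum_congr rfl fun i _ => ?_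
      simp only [hsplit]
      rw [integral_add (hint' i) (hint i), isStageLaw_stageLaw hℓ hD k hk fun u => u i]
      simp only [castVec]
      ring

lemma integrable_stageLaw (hν : ∀ i, Integrable (fun s : Fin m → ℕ => (s i : ℝ)) ν) (k : ℕ)
    (i : Fin m) : Integrable (fun w : Fin m → ℕ => (w i : ℝ)) (stageLaw lam ν ℓ k) :=
  integrable_cpLaw hν _ i

/-- The value of the relaxed program is the lower bound. -/
lemma lowerBound_eq_costToGo (hν : ∀ i, Integrable (fun s : Fin m → ℕ => (s i : ℝ)) ν)
    (hℓ : IsLeadTimes S.K ℓ L) (hD : IsCompoundPoisson P (-L) lam ν D) :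
    lowerBound S ℓ P D = costToGo S (stageLaw lam ν ℓ) S.K 0 0 :=
  lowerBound_eq (isStageLaw_stageLaw hℓ hD) (integrable_stageLaw hν)
    (sum_integral_demand_eq hν hℓ hD le_rfl).2

section

variable (hν : ∀ i, Integrable (fun s : Fin m → ℕ => (s i : ℝ)) ν)
  (hℓ : IsLeadTimes S.K ℓ L) (hD : IsCompoundPoisson P (-L) lam ν D) {t : ℝ} (ht : 0 ≤ t)
  {y : Ω → Fin n → ℝ} (hy : ∀ j, Measurable[history D (t - ℓ (S.grp j))] fun ω => y ω j)
include hν hℓ hD ht hy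

/-- Conditioning on the history up to time `t - ℓ (k + 1)`. -/
lemma lintegral_costToGo_stage {k : ℕ} (hk : k < S.K) :
    ∫⁻ ω, ENNReal.ofReal (costToGo S (stageLaw lam ν ℓ) k (y ω)
      (demand D (t - ℓ S.K) (t - ℓ k) ω)) ∂P =
    ∫⁻ ω, ENNReal.ofReal (∫ w, costToGo S (stageLaw lam ν ℓ) k (y ω)
      (demand D (t - ℓ S.K) (t - ℓ (k + 1)) ω + castVec w) ∂(stageLaw lam ν ℓ (k + 1))) ∂P := by
  have hρ : ∀ k i, Integrable (fun w : Fin m → ℕ => (w i : ℝ)) (stageLaw lam ν ℓ k) :=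
    integrable_stageLaw hν
  have h1 : t - ℓ (k + 1) ≤ t - ℓ k := sub_le_sub_left (hℓ.mono (Nat.le_succ k) hk) t
  have h0 : t - ℓ S.K ≤ t - ℓ (k + 1) := sub_le_sub_left (hℓ.mono hk le_rfl) t
  have h2 : -L ≤ t - ℓ (k + 1) := by
    have := hℓ.mono (show k + 1 ≤ S.K from hk) le_rfl
    rw [hℓ.longest] at this
    linarith
  -- decisions of later stages do not matter; the others are known at time `t - ℓ (k + 1)`
  let y' : Ω → Fin n → ℝ := fun ω j => if k < S.grp j then y ω j else 0
  have hcongr : ∀ ω x, costToGo S (stageLaw lam ν ℓ) k (y ω) x =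
      costToGo S (stageLaw lam ν ℓ) k (y' ω) x := fun ω x =>
    costToGo_congr k (fun j hj => by simp [y', hj]) x
  let U : Ω → (Fin n → ℝ) × (Fin m → ℝ) :=
    fun ω => (y' ω, demand D (t - ℓ S.K) (t - ℓ (k + 1)) ω)
  have hU : Measurable[history D (t - ℓ (k + 1))] U := by
    refine measurable_prodMk_demand (fun j => ?_) (measurable_history h0) (measurable_history le_rfl)
    by_cases hj : k < S.grp j
    · simp only [y', hj, if_true]
      exact (hy j).mono (history_mono (sub_le_sub_left (hℓ.mono hj (S.grp_mem j).2) t)) le_rfl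
    · simp only [y', hj, if_false]
      exact measurable_const
  let f : ((Fin n → ℝ) × (Fin m → ℝ)) × (Fin m → ℕ) → ℝ≥0∞ := fun p =>
    ENNReal.ofReal (costToGo S (stageLaw lam ν ℓ) k p.1.1 (p.1.2 + castVec p.2))
  have hcast : Measurable (castVec : (Fin m → ℕ) → Fin m → ℝ) := Measurable.of_discrete
  have hf : Measurable f := by
    have hg : Measurable fun p : ((Fin n → ℝ) × (Fin m → ℝ)) × (Fin m → ℕ) =>
        (p.1.1, p.1.2 + castVec p.2) :=
      measurable_fst.fst.prodMk (measurable_fst.snd.add (hcast.comp measurable_snd))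
    exact ENNReal.measurable_ofReal.comp ((continuous_costToGo (S := S) hρ k).measurable.comp hg)
  have key := hD.lintegral_history_inc h2 h1 hU hf
  rw [show t - ℓ k - (t - ℓ (k + 1)) = ℓ (k + 1) - ℓ (k + 1 - 1) by
    rw [Nat.add_sub_cancel]; ring] at key
  calc _ = ∫⁻ ω, f (U ω, inc D (t - ℓ (k + 1)) (t - ℓ k) ω) ∂P := by
        refine lintegral_congr fun ω => ?_
        simp only [f, U]
        rw [hcongr, ← hD.demand_eq h1, demand_add_demand]
    _ = ∫⁻ ω, ∫⁻ w, f (U ω, w) ∂(stageLaw lam ν ℓ (k + 1)) ∂P := key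
    _ = _ := by
        refine lintegral_congr fun ω => ?_
        simp only [hcongr]
        exact (ofReal_integral_eq_lintegral_ofReal (integrable_costToGo hρ k (k + 1) _ _)
          (Eventually.of_forall fun w => costToGo_nonneg _ _ _)).symm

lemma lintegral_costToGo_succ_le {k : ℕ} (hk : k < S.K) :
    ∫⁻ ω, ENNReal.ofReal (costToGo S (stageLaw lam ν ℓ) (k + 1) (y ω)
      (demand D (t - ℓ S.K) (t - ℓ (k + 1)) ω)) ∂P ≤
    ∫⁻ ω, ENNReal.ofReal (costToGo S (stageLaw lam ν ℓ) k (y ω)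
      (demand D (t - ℓ S.K) (t - ℓ k) ω)) ∂P := by
  rw [lintegral_costToGo_stage hν hℓ hD ht hy hk]
  refine lintegral_mono fun ω => ENNReal.ofReal_le_ofReal ?_
  have := costToGo_succ_le (S := S) (ρ := stageLaw lam ν ℓ) k (y ω)
    (demand D (t - ℓ S.K) (t - ℓ (k + 1)) ω) fun j => y ω j
  rwa [Spec.setBlock_self] at this

omit hν hℓ ht hy [IsProbabilityMeasure ν] hD in
lemma lintegral_costToGo_last {ρ : ℕ → Measure (Fin m → ℕ)} :
    ∫⁻ ω, ENNReal.ofReal (costToGo S ρ S.K (y ω) (demand D (t - ℓ S.K) (t - ℓ S.K) ω)) ∂P =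
      ENNReal.ofReal (costToGo S ρ S.K 0 0) := by
  have h : ∀ ω, costToGo S ρ S.K (y ω) (demand D (t - ℓ S.K) (t - ℓ S.K) ω) =
      costToGo S ρ S.K 0 0 := fun ω => by
    rw [costToGo_congr S.K (y' := 0) fun j hj => absurd (S.grp_mem j).2 (by omega)]
    congr 1
    ext i
    simp [demand]
  simp [h]

/-- Decisions that are based on the history only cost at least the value of the relaxed program. -/
lemma lowerBound_le_lintegral_lpCost :
    ENNReal.ofReal (lowerBound S ℓ P D) ≤
      ∫⁻ ω, ENNReal.ofReal (S.lpCost (S.balance (y ω) (demand D (t - ℓ S.K) t ω))) ∂P := by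
  rw [lowerBound_eq_costToGo hν hℓ hD]
  have h : ∀ k ≤ S.K, ENNReal.ofReal (costToGo S (stageLaw lam ν ℓ) S.K 0 0) ≤
      ∫⁻ ω, ENNReal.ofReal (costToGo S (stageLaw lam ν ℓ) k (y ω)
        (demand D (t - ℓ S.K) (t - ℓ k) ω)) ∂P := by
    intro k hk
    induction hk using Nat.decreasingInduction with
    | self => exact lintegral_costToGo_last.ge
    | of_succ k hk ih => exact ih.trans (lintegral_costToGo_succ_le hν hℓ hD ht hy hk)
  have h0 := h 0 (Nat.zero_le _)
  rwa [hℓ.zero, sub_zero] at h0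

/-- Decisions that are optimal at every stage attain the value of the relaxed program. -/
lemma lintegral_lpCost_eq_lowerBound
    (hopt : ∀ k < S.K, ∀ᵐ ω ∂P, IsStageOptimal S ℓ P D (k + 1) (y ω)
      (demand D (t - ℓ S.K) (t - ℓ (k + 1)) ω) fun j => y ω j) :
    ∫⁻ ω, ENNReal.ofReal (S.lpCost (S.balance (y ω) (demand D (t - ℓ S.K) t ω))) ∂P =
      ENNReal.ofReal (lowerBound S ℓ P D) := by
  rw [lowerBound_eq_costToGo hν hℓ hD]
  have h : ∀ k ≤ S.K, ∫⁻ ω, ENNReal.ofReal (costToGo S (stageLaw lam ν ℓ) k (y ω)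
      (demand D (t - ℓ S.K) (t - ℓ k) ω)) ∂P =
        ENNReal.ofReal (costToGo S (stageLaw lam ν ℓ) S.K 0 0) := by
    intro k hk
    induction hk using Nat.decreasingInduction with
    | self => exact lintegral_costToGo_last
    | of_succ k hk ih =>
      rw [lintegral_costToGo_stage hν hℓ hD ht hy hk, ← ih]
      refine lintegral_congr_ae ?_
      filter_upwards [hopt k hk] with ω hω
      have := hω.costToGo_eq (isStageLaw_stageLaw hℓ hD) (integrable_stageLaw hν) hk
      rw [Spec.setBlock_self] at this
      rw [this]
  have h0 := h 0 (Nat.zero_le _)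
  rwa [hℓ.zero, sub_zero] at h0

end

end

/-! ### Cost rates of policies -/

section

variable {m n : ℕ} {S : Spec m n} {Ω : Type*} [MeasurableSpace Ω] {P : Measure Ω}
  [IsProbabilityMeasure P] {ℓ : ℕ → ℝ} {L : ℝ} {D : ℝ → Ω → Fin m → ℕ} {lam : ℝ≥0}
  {ν : Measure (Fin m → ℕ)} [IsProbabilityMeasure ν]
  {R : ℝ → Ω → Fin n → ℕ} {Z : ℝ → Ω → Fin m → ℕ}

/-- Component balance at time `t`: demand over the last lead time less the inventory position one
lead time ago. -/
def policyBalance (S : Spec m n) (ℓ : ℕ → ℝ) (D : ℝ → Ω → Fin m → ℕ) (R : ℝ → Ω → Fin n → ℕ)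
    (t : ℝ) (ω : Ω) (j : Fin n) : ℝ :=
  S.usage j (fun i => (D t ω i : ℝ)) - R (t - ℓ (S.grp j)) ω j

omit [MeasurableSpace Ω] in
lemma onHand_eq (t : ℝ) (ω : Ω) (j : Fin n) :
    onHand S ℓ R Z t ω j = S.usage j (backlog D Z t ω) - policyBalance S ℓ D R t ω j := by
  have : S.usage j (backlog D Z t ω) =
      S.usage j (fun i => (D t ω i : ℝ)) - S.usage j fun i => (Z t ω i : ℝ) := by
    rw [← S.usage_sub]; rfl
  rw [onHand, policyBalance, this]
  ring

omit [MeasurableSpace Ω] in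
lemma invPos_eq (t : ℝ) (ω : Ω) (j : Fin n) :
    invPos S ℓ D R Z t ω j = R t ω j - S.usage j fun i => (D t ω i : ℝ) := by
  have : S.usage j (backlog D Z t ω) =
      S.usage j (fun i => (D t ω i : ℝ)) - S.usage j fun i => (Z t ω i : ℝ) := by
    rw [← S.usage_sub]; rfl
  rw [invPos, onHand, inTransit, this]
  ring

omit [MeasurableSpace Ω] in
lemma policyBalance_sub_idealBalance (Y : ℝ → Ω → Fin n → ℝ) (t : ℝ) (ω : Ω) (j : Fin n) :
    policyBalance S ℓ D R t ω j - idealBalance S ℓ D Y t ω j =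
      targetPos S ℓ D Y (t - ℓ (S.grp j)) ω j - invPos S ℓ D R Z (t - ℓ (S.grp j)) ω j := by
  have : S.usage j (demand D (t - ℓ (S.grp j)) t ω) = S.usage j (fun i => (D t ω i : ℝ)) -
      S.usage j fun i => (D (t - ℓ (S.grp j)) ω i : ℝ) := by
    rw [← S.usage_sub]; rfl
  rw [invPos_eq, policyBalance, idealBalance, this]
  ring

omit [MeasurableSpace Ω] in
lemma idealBalance_eq (Y : ℝ → Ω → Fin n → ℝ) (t : ℝ) (ω : Ω) :
    idealBalance S ℓ D Y t ω =
      S.balance (fun j => Y (t - ℓ (S.grp j)) ω j) (demand D (t - ℓ S.K) t ω) := by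
  ext j
  rw [idealBalance, targetPos, Spec.balance, ← demand_add_demand (t - ℓ S.K) (t - ℓ (S.grp j)) t,
    S.usage_add, show t - ℓ (S.grp j) - (ℓ S.K - ℓ (S.grp j)) = t - ℓ S.K by ring]
  ring

omit [MeasurableSpace Ω] in
lemma policyBalance_eq (t : ℝ) (ω : Ω) :
    policyBalance S ℓ D R t ω = S.balance (fun j => (R (t - ℓ (S.grp j)) ω j : ℝ) -
      S.usage j fun i => (D (t - ℓ S.K) ω i : ℝ)) (demand D (t - ℓ S.K) t ω) := by
  ext j
  have : S.usage j (demand D (t - ℓ S.K) t ω) = S.usage j (fun i => (D t ω i : ℝ)) -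
      S.usage j fun i => (D (t - ℓ S.K) ω i : ℝ) := by
    rw [← S.usage_sub]; rfl
  rw [policyBalance, Spec.balance, this]
  ring

omit [MeasurableSpace Ω] in
lemma IsPolicy.backlog_mem (hpol : IsPolicy S ℓ D R Z) {t : ℝ} (ht : 0 ≤ t) (ω : Ω) :
    backlog D Z t ω ∈ S.backlogs (policyBalance S ℓ D R t ω) := by
  refine ⟨fun i => hpol.backlog_nonneg ω i t ht, fun j => ?_⟩
  have := hpol.onHand_nonneg ω j t ht
  rw [onHand_eq (D := D)] at this
  linarith

section Measurability

variable (hD : ∀ t, Measurable (D t)) (hpol : IsPolicy S ℓ D R Z)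
include hD

omit [IsProbabilityMeasure P] in
lemma measurable_usage_demand (t : ℝ) (j : Fin n) :
    Measurable fun ω => S.usage j fun i => (D t ω i : ℝ) := by
  have hc : Measurable fun w : Fin m → ℕ => S.usage j fun i => (w i : ℝ) := Measurable.of_discrete
  exact hc.comp (hD t)

include hpol

lemma IsPolicy.measurable_policyBalance (t : ℝ) (j : Fin n) :
    Measurable fun ω => policyBalance S ℓ D R t ω j := by
  have hR := (hpol.adapted_R (t - ℓ (S.grp j))).mono (history_le hD _) le_rfl
  have hc : Measurable fun w : Fin n → ℕ => (w j : ℝ) := Measurable.of_discrete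
  exact (measurable_usage_demand hD t j).sub (hc.comp hR)

lemma IsPolicy.measurable_backlog (t : ℝ) (i : Fin m) :
    Measurable fun ω => backlog D Z t ω i := by
  have hZ := (hpol.adapted_Z t).mono (history_le hD _) le_rfl
  have hc : Measurable fun w : Fin m → ℕ => (w i : ℝ) := Measurable.of_discrete
  exact (hc.comp (hD t)).sub (hc.comp hZ)

lemma IsPolicy.measurable_onHand (t : ℝ) (j : Fin n) :
    Measurable fun ω => onHand S ℓ R Z t ω j := by
  simp only [onHand_eq (D := D), Spec.usage]
  exact (Finset.measurable_fun_sum _ fun i _ =>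
    (hpol.measurable_backlog hD t i).const_mul _).sub (hpol.measurable_policyBalance hD t j)

omit [IsProbabilityMeasure P] in
/-- The expected cost rate is the expectation of `c · B - h · Q`, where `Q` is the component
balance. -/
lemma IsPolicy.costRate_eq {t : ℝ} (ht : 0 ≤ t) :
    costRate S ℓ P D R Z t = ∫⁻ ω, ENNReal.ofReal (∑ i, S.c i * backlog D Z t ω i -
      ∑ j, S.h j * policyBalance S ℓ D R t ω j) ∂P := by
  have h1 : ∀ ω, ENNReal.ofReal (∑ i, S.c i * backlog D Z t ω i -
      ∑ j, S.h j * policyBalance S ℓ D R t ω j) =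
      ∑ j, ENNReal.ofReal (S.h j) * ENNReal.ofReal (onHand S ℓ R Z t ω j) +
        ∑ i, ENNReal.ofReal (S.b i) * ENNReal.ofReal (backlog D Z t ω i) := by
    intro ω
    have hb : ∀ i, 0 ≤ S.b i * backlog D Z t ω i := fun i =>
      mul_nonneg (S.b_pos i).le (hpol.backlog_nonneg ω i t ht)
    have hh : ∀ j, 0 ≤ S.h j * onHand S ℓ R Z t ω j := fun j =>
      mul_nonneg (S.h_pos j).le (hpol.onHand_nonneg ω j t ht)
    rw [S.cost_eq]
    simp only [← onHand_eq]
    rw [add_comm, ENNReal.ofReal_add (Finset.sum_nonneg fun j _ => hh j)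
      (Finset.sum_nonneg fun i _ => hb i), ENNReal.ofReal_sum_of_nonneg fun j _ => hh j,
      ENNReal.ofReal_sum_of_nonneg fun i _ => hb i]
    simp only [ENNReal.ofReal_mul (S.h_pos _).le, ENNReal.ofReal_mul (S.b_pos _).le]
  have mh : ∀ j, Measurable fun ω => ENNReal.ofReal (onHand S ℓ R Z t ω j) := fun j =>
    ENNReal.measurable_ofReal.comp (hpol.measurable_onHand hD t j)
  have mb : ∀ i, Measurable fun ω => ENNReal.ofReal (backlog D Z t ω i) := fun i =>
    ENNReal.measurable_ofReal.comp (hpol.measurable_backlog hD t i)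
  simp only [h1]
  rw [lintegral_add_left (Finset.measurable_fun_sum _ fun j _ => (mh j).const_mul _),
    lintegral_finsetSum _ fun j _ => (mh j).const_mul _,
    lintegral_finsetSum _ fun i _ => (mb i).const_mul _, costRate]
  simp only [lintegral_const_mul _ (mh _), lintegral_const_mul _ (mb _)]

end Measurability

section

variable (hν : ∀ i, Integrable (fun s : Fin m → ℕ => (s i : ℝ)) ν)
  (hℓ : IsLeadTimes S.K ℓ L) (hD : IsCompoundPoisson P (-L) lam ν D)
include hν hℓ hD

/-- No feasible policy has a cost rate below the lower bound, at any time. -/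
lemma IsPolicy.lowerBound_le_costRate (hpol : IsPolicy S ℓ D R Z) {t : ℝ} (ht : 0 ≤ t) :
    ENNReal.ofReal (lowerBound S ℓ P D) ≤ costRate S ℓ P D R Z t := by
  rw [hpol.costRate_eq hD.measurable ht]
  let y : Ω → Fin n → ℝ := fun ω j => (R (t - ℓ (S.grp j)) ω j : ℝ) -
      S.usage j fun i => (D (t - ℓ S.K) ω i : ℝ)
  have hy : ∀ j, Measurable[history D (t - ℓ (S.grp j))] fun ω => y ω j := by
    intro j
    have hc : Measurable fun w : Fin n → ℕ => (w j : ℝ) := Measurable.of_discrete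
    have hu : Measurable fun w : Fin m → ℕ => S.usage j fun i => (w i : ℝ) := Measurable.of_discrete
    have h0 : t - ℓ S.K ≤ t - ℓ (S.grp j) := sub_le_sub_left (hℓ.mono (S.grp_mem j).2 le_rfl) t
    exact Measurable.sub (hc.comp (hpol.adapted_R (t - ℓ (S.grp j))))
      (hu.comp (measurable_history h0))
  refine (lowerBound_le_lintegral_lpCost hν hℓ hD ht hy).trans
    (lintegral_mono fun ω => ENNReal.ofReal_le_ofReal ?_)
  rw [← policyBalance_eq]
  exact Spec.lpCost_le (hpol.backlog_mem ht ω)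

variable {Y : ℝ → Ω → Fin n → ℝ} {Bs : ℝ → Ω → Fin m → ℝ}

lemma IsSPSolution.lintegral_lpCost (hY : IsSPSolution S ℓ P D Y) {t : ℝ} (ht : 0 ≤ t) :
    ∫⁻ ω, ENNReal.ofReal (S.lpCost (idealBalance S ℓ D Y t ω)) ∂P =
      ENNReal.ofReal (lowerBound S ℓ P D) := by
  simp only [idealBalance_eq]
  refine lintegral_lpCost_eq_lowerBound hν hℓ hD ht
    (fun j => hY.adapted j _ (by linarith)) fun k hk => ?_
  have h := hY.optimal (k + 1) (by omega) hk (t - ℓ (k + 1)) (by linarith)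
  filter_upwards [h] with ω hω
  convert hω using 1
  · ext j; congr 1; ring
  · congr 1; ring
  · ext j; rw [j.2]

/-- The cost rate exceeds the lower bound by at most the weighted expected distances of backlogs and
inventory positions to their targets. -/
lemma IsPolicy.costRate_le (hpol : IsPolicy S ℓ D R Z) (hY : IsSPSolution S ℓ P D Y)
    (hBs : IsIdealBacklog S ℓ P D Y Bs) {t : ℝ} (ht : 0 ≤ t) :
    costRate S ℓ P D R Z t ≤ ENNReal.ofReal (lowerBound S ℓ P D) +
      (∑ i, ENNReal.ofReal (S.c i) * ∫⁻ ω, ENNReal.ofReal |backlog D Z t ω i - Bs t ω i| ∂P +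
        ∑ j, ENNReal.ofReal (S.h j) * ∫⁻ ω, ENNReal.ofReal
          |invPos S ℓ D R Z (t - ℓ (S.grp j)) ω j - targetPos S ℓ D Y (t - ℓ (S.grp j)) ω j| ∂P) := by
  have hDm := hD.measurable
  have mB : ∀ i, Measurable fun ω => ENNReal.ofReal |backlog D Z t ω i - Bs t ω i| := fun i =>
    ENNReal.measurable_ofReal.comp (((hpol.measurable_backlog hDm t i).sub
      ((measurable_pi_apply i).comp (hBs.measurable t ht))).abs)
  have mI : ∀ j, Measurable fun ω => ENNReal.ofReal
      |invPos S ℓ D R Z (t - ℓ (S.grp j)) ω j - targetPos S ℓ D Y (t - ℓ (S.grp j)) ω j| := by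
    intro j
    have hR := (hpol.adapted_R (t - ℓ (S.grp j))).mono (history_le hDm _) le_rfl
    have hc : Measurable fun w : Fin n → ℕ => (w j : ℝ) := Measurable.of_discrete
    have hYm := (hY.adapted j (t - ℓ (S.grp j)) (by linarith)).mono (history_le hDm _) le_rfl
    have htar : ∀ s s', Measurable fun ω => S.usage j (demand D s s' ω) := fun s s' => by
      have : (fun ω => S.usage j (demand D s s' ω)) = fun ω =>
          S.usage j (fun i => (D s' ω i : ℝ)) - S.usage j fun i => (D s ω i : ℝ) := by
        ext ω; rw [← S.usage_sub]; rfl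
      rw [this]
      exact (measurable_usage_demand hDm s' j).sub (measurable_usage_demand hDm s j)
    simp only [invPos_eq, targetPos]
    exact ENNReal.measurable_ofReal.comp
      (((hc.comp hR).sub (measurable_usage_demand hDm _ j)).sub (hYm.sub (htar _ _))).abs
  have mBI : Measurable fun ω =>
      ∑ i, ENNReal.ofReal (S.c i) * ENNReal.ofReal |backlog D Z t ω i - Bs t ω i| +
        ∑ j, ENNReal.ofReal (S.h j) * ENNReal.ofReal
          |invPos S ℓ D R Z (t - ℓ (S.grp j)) ω j - targetPos S ℓ D Y (t - ℓ (S.grp j)) ω j| :=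
    (Finset.measurable_fun_sum _ fun i _ => (mB i).const_mul _).add
      (Finset.measurable_fun_sum _ fun j _ => (mI j).const_mul _)
  rw [hpol.costRate_eq hDm ht, ← hY.lintegral_lpCost hν hℓ hD ht]
  simp only [← lintegral_const_mul _ (mB _), ← lintegral_const_mul _ (mI _)]
  rw [← lintegral_finsetSum _ fun i _ => (mB i).const_mul _,
    ← lintegral_finsetSum _ fun j _ => (mI j).const_mul _,
    ← lintegral_add_left (Finset.measurable_fun_sum _ fun i _ => (mB i).const_mul _),
    ← lintegral_add_right _ mBI]
  refine lintegral_mono_ae ?_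
  filter_upwards [hBs.optimal t ht] with ω hω
  have hc : ∀ i, 0 ≤ S.c i * |backlog D Z t ω i - Bs t ω i| := fun i =>
    mul_nonneg (S.c_pos i).le (abs_nonneg _)
  have hh : ∀ j, 0 ≤ S.h j * |invPos S ℓ D R Z (t - ℓ (S.grp j)) ω j -
      targetPos S ℓ D Y (t - ℓ (S.grp j)) ω j| := fun j =>
    mul_nonneg (S.h_pos j).le (abs_nonneg _)
  simp only [← ENNReal.ofReal_mul (S.h_pos _).le, ← ENNReal.ofReal_mul (S.c_pos _).le]
  rw [← ENNReal.ofReal_sum_of_nonneg fun i _ => hc i,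
    ← ENNReal.ofReal_sum_of_nonneg fun j _ => hh j,
    ← ENNReal.ofReal_add (Finset.sum_nonneg fun i _ => hc i) (Finset.sum_nonneg fun j _ => hh j),
    ← ENNReal.ofReal_add (Spec.lpCost_nonneg _)
      (add_nonneg (Finset.sum_nonneg fun i _ => hc i) (Finset.sum_nonneg fun j _ => hh j)),
    hω.lpCost_eq]
  refine ENNReal.ofReal_le_ofReal ?_
  have h1 : ∑ i, S.c i * backlog D Z t ω i ≤
      ∑ i, S.c i * Bs t ω i + ∑ i, S.c i * |backlog D Z t ω i - Bs t ω i| := by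
    rw [← Finset.sum_add_distrib]
    refine Finset.sum_le_sum fun i _ => ?_
    rw [← mul_add]
    exact mul_le_mul_of_nonneg_left (by linarith [le_abs_self (backlog D Z t ω i - Bs t ω i)])
      (S.c_pos i).le
  have h2 : ∑ j, S.h j * idealBalance S ℓ D Y t ω j ≤
      ∑ j, S.h j * policyBalance S ℓ D R t ω j +
        ∑ j, S.h j * |invPos S ℓ D R Z (t - ℓ (S.grp j)) ω j -
          targetPos S ℓ D Y (t - ℓ (S.grp j)) ω j| := by
    rw [← Finset.sum_add_distrib]
    refine Finset.sum_le_sum fun j _ => ?_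
    rw [← mul_add]
    refine mul_le_mul_of_nonneg_left ?_ (S.h_pos j).le
    have h3 := policyBalance_sub_idealBalance (S := S) (ℓ := ℓ) (D := D) (R := R) (Z := Z) Y t ω j
    linarith [le_abs_self (invPos S ℓ D R Z (t - ℓ (S.grp j)) ω j -
          targetPos S ℓ D Y (t - ℓ (S.grp j)) ω j)]
  linarith

end

omit [IsProbabilityMeasure P] in
/-- Undoing the diffusion scaling at a single time. -/
lemma lintegral_abs_sub_le_expSupDist {ι : Type*} {f g : ℝ → Ω → ι → ℝ} {t₀ : ℝ} (hL : 0 < L)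
    {t : ℝ} (ht : t₀ ≤ t / L) (i : ι) :
    ∫⁻ ω, ENNReal.ofReal |f t ω i - g t ω i| ∂P ≤
      ENNReal.ofReal √L * expSupDist P t₀ (scaled L f) (scaled L g) i := by
  have hs : 0 < √L := Real.sqrt_pos.2 hL
  have h1 : ∀ ω, ENNReal.ofReal |f t ω i - g t ω i| =
      ENNReal.ofReal √L * ENNReal.ofReal |scaled L f (t / L) ω i - scaled L g (t / L) ω i| := by
    intro ω
    rw [← ENNReal.ofReal_mul hs.le, scaled, scaled, mul_div_cancel₀ t hL.ne', ← sub_div, abs_div,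
      abs_of_pos hs, mul_div_cancel₀ _ hs.ne']
  simp only [h1]
  rw [lintegral_const_mul' _ _ ENNReal.ofReal_ne_top, expSupDist]
  gcongr with ω
  exact le_iSup₂ (f := fun t (_ : t ∈ Set.Ici t₀) =>
    ENNReal.ofReal |scaled L f t ω i - scaled L g t ω i|) (t / L) ht

section AverageCost

lemma inv_mul_lintegral_const {T : ℝ} (hT : 0 < T) (C : ℝ≥0∞) :
    (ENNReal.ofReal T)⁻¹ * ∫⁻ _ in Set.Ioc 0 T, C = C := by
  rw [lintegral_const, Measure.restrict_apply_univ, Real.volume_Ioc, sub_zero, mul_comm, mul_assoc,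
    ENNReal.mul_inv_cancel (by simpa using hT) ENNReal.ofReal_ne_top, mul_one]

omit [IsProbabilityMeasure P] in
lemma le_avgCost {C : ℝ≥0∞} (h : ∀ t, 0 ≤ t → C ≤ costRate S ℓ P D R Z t) :
    C ≤ avgCost S ℓ P D R Z := by
  rw [avgCost, ← limsup_const (f := (atTop : Filter ℝ)) C]
  refine limsup_le_limsup ?_
  filter_upwards [eventually_gt_atTop 0] with T hT
  rw [← inv_mul_lintegral_const hT C]
  gcongr 1
  exact setLIntegral_mono' measurableSet_Ioc fun t ht => h t ht.1.le

omit [IsProbabilityMeasure P] in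
lemma avgCost_le {C : ℝ≥0∞} (h : ∀ t, 0 ≤ t → costRate S ℓ P D R Z t ≤ C) :
    avgCost S ℓ P D R Z ≤ C := by
  rw [avgCost, ← limsup_const (f := (atTop : Filter ℝ)) C]
  refine limsup_le_limsup ?_
  filter_upwards [eventually_gt_atTop 0] with T hT
  rw [← inv_mul_lintegral_const hT C]
  gcongr 1
  exact setLIntegral_mono' measurableSet_Ioc fun t ht => h t ht.1.le

end AverageCost

/-! ### Growth of the lower bound -/

/-- The cost rate grows at least linearly in the balance of every component. -/
lemma Spec.exists_mul_abs_le_lpCost (j : Fin n) :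
    ∃ κ > 0, ∀ q : Fin n → ℝ, κ * |q j| ≤ S.lpCost q := by
  obtain ⟨i₀, hi₀⟩ := S.row_ne_zero j
  set r := ∑ i, (S.A j i : ℝ) / S.b i with hr
  have hr0 : 0 < r := Finset.sum_pos' (fun i _ => div_nonneg (Nat.cast_nonneg _) (S.b_pos i).le)
    ⟨i₀, Finset.mem_univ _, div_pos (by exact_mod_cast Nat.pos_of_ne_zero hi₀) (S.b_pos i₀)⟩
  refine ⟨min r⁻¹ (S.h j), lt_min (inv_pos.2 hr0) (S.h_pos j), fun q => ?_⟩
  set κ := min r⁻¹ (S.h j)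
  have hκ0 : 0 < κ := lt_min (inv_pos.2 hr0) (S.h_pos j)
  refine Spec.le_lpCost fun β hβ => ?_
  rw [S.cost_eq]
  have hbβ : ∀ i, 0 ≤ S.b i * β i := fun i => mul_nonneg (S.b_pos i).le (hβ.1 i)
  have h1 : S.usage j β ≤ r * ∑ i, S.b i * β i := by
    rw [Spec.usage, hr, Finset.sum_mul]
    refine Finset.sum_le_sum fun i _ => ?_
    calc (S.A j i : ℝ) * β i = (S.A j i : ℝ) / S.b i * (S.b i * β i) := by
          have := (S.b_pos i).ne'
          field_simp
      _ ≤ _ := mul_le_mul_of_nonneg_left (Finset.single_le_sum (f := fun i => S.b i * β i)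
          (fun i _ => hbβ i) (Finset.mem_univ i)) (div_nonneg (Nat.cast_nonneg _) (S.b_pos i).le)
  have h2 : S.h j * (S.usage j β - q j) ≤ ∑ j, S.h j * (S.usage j β - q j) :=
    Finset.single_le_sum (f := fun j => S.h j * (S.usage j β - q j))
      (fun j _ => mul_nonneg (S.h_pos j).le (sub_nonneg.2 (hβ.2 j))) (Finset.mem_univ j)
  have h3 : κ * S.usage j β ≤ ∑ i, S.b i * β i := by
    calc κ * S.usage j β ≤ r⁻¹ * S.usage j β :=
          mul_le_mul_of_nonneg_right (min_le_left _ _) (S.usage_nonneg j hβ.1)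
      _ ≤ r⁻¹ * (r * ∑ i, S.b i * β i) := mul_le_mul_of_nonneg_left h1 (inv_pos.2 hr0).le
      _ = _ := by rw [← mul_assoc, inv_mul_cancel₀ hr0.ne', one_mul]
  have h4 : κ * (S.usage j β - q j) ≤ S.h j * (S.usage j β - q j) :=
    mul_le_mul_of_nonneg_right (min_le_right _ _) (sub_nonneg.2 (hβ.2 j))
  have h5 := S.usage_nonneg j hβ.1
  have h6 := hβ.2 j
  have h7 : |q j| ≤ S.usage j β + (S.usage j β - q j) := abs_le.2 ⟨by linarith, by linarith⟩
  have h8 := mul_le_mul_of_nonneg_left h7 hκ0.le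
  rw [mul_add] at h8
  linarith

/-- The lower bound grows at least like the square root of the longest lead time: the decision for a
component with that lead time precedes all demand that it serves. -/
lemma exists_mul_sqrt_le_lowerBound (hK : 1 ≤ S.K)
    (hν : ∀ i, Integrable (fun s : Fin m → ℕ => (s i : ℝ)) ν)
    (hmean : ∀ i, 0 < (lam : ℝ) * ∫ s, (s i : ℝ) ∂ν) :
    ∃ κ > 0, ∀ {Ω : Type*} [MeasurableSpace Ω] (P : Measure Ω) [IsProbabilityMeasure P]
      (ℓ : ℕ → ℝ) (L : ℝ) (D : ℝ → Ω → Fin m → ℕ) (Y : ℝ → Ω → Fin n → ℝ),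
      IsLeadTimes S.K ℓ L → IsCompoundPoisson P (-L) lam ν D → IsSPSolution S ℓ P D Y →
      1 ≤ lam * L → κ * √L ≤ lowerBound S ℓ P D := by
  obtain ⟨j, hj⟩ := S.grp_surj S.K hK le_rfl
  obtain ⟨i₀, hi₀⟩ := S.row_ne_zero j
  obtain ⟨κ₁, hκ₁, hlp⟩ := Spec.exists_mul_abs_le_lpCost (S := S) j
  have hlam : (0 : ℝ) < lam := by
    have h0 : (0 : ℝ) ≤ lam := lam.2
    rcases h0.lt_or_eq with h | h
    · exact h
    · have := hmean i₀
      rw [← h, zero_mul] at this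
      exact absurd this (lt_irrefl _)
  have hmean' : ∀ i, 0 < ∫ s, (s i : ℝ) ∂ν := fun i => pos_of_mul_pos_right (hmean i) hlam.le
  set μ := ∑ i, (S.A j i : ℝ) * ∫ s, (s i : ℝ) ∂ν with hμ
  have hμ0 : 0 < μ := Finset.sum_pos' (fun i _ => mul_nonneg (Nat.cast_nonneg _) (hmean' i).le)
    ⟨i₀, Finset.mem_univ _, mul_pos (by exact_mod_cast Nat.pos_of_ne_zero hi₀) (hmean' i₀)⟩
  set η := 1 - Real.exp (-(2 / Real.pi ^ 2)) with hη
  have hη0 : 0 < η := sub_pos.2 (Real.exp_lt_one_iff.2 (by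
    have := Real.pi_pos
    have : 0 < 2 / Real.pi ^ 2 := by positivity
    linarith))
  refine ⟨κ₁ * (μ * (η * √lam)), by positivity, ?_⟩
  intro Ω _ P _ ℓ L D Y hℓ hD hY hL
  have hL0 : 0 < L := by
    by_contra h
    nlinarith [not_lt.1 h]
  have hr : (1 : ℝ≥0) ≤ lam * L.toNNReal := by
    rw [← NNReal.coe_le_coe, NNReal.coe_mul, Real.coe_toNNReal _ hL0.le]
    exact_mod_cast hL
  have hval := hY.lintegral_lpCost hν hℓ hD (le_refl 0)
  simp only [idealBalance_eq, hℓ.longest, zero_sub] at hval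
  have hadapt : Measurable[history D (-L)] fun ω => Y (-L) ω j := by
    have := hY.adapted j (-L) (by rw [hj, hℓ.longest])
    exact this
  have hf : Measurable fun p : ℝ × (Fin m → ℕ) =>
      ENNReal.ofReal κ₁ * ENNReal.ofReal |∑ i, (S.A j i : ℝ) * (p.2 i : ℝ) - p.1| := by
    have hc : Measurable fun w : Fin m → ℕ => ∑ i, (S.A j i : ℝ) * (w i : ℝ) :=
      Measurable.of_discrete
    exact (ENNReal.measurable_ofReal.comp
      ((hc.comp measurable_snd).sub measurable_fst).abs).const_mul _
  have hcond := hD.lintegral_history_inc (le_refl (-L)) (by linarith : -L ≤ 0) hadapt hf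
  have hlower : ENNReal.ofReal (κ₁ * (μ * (η * √(lam * L)))) ≤
      ENNReal.ofReal (lowerBound S ℓ P D) := by
    calc ENNReal.ofReal (κ₁ * (μ * (η * √(lam * L))))
        = ∫⁻ _, ENNReal.ofReal (κ₁ * (μ * (η * √(lam * L)))) ∂P := by simp
      _ ≤ ∫⁻ ω, ∫⁻ w, ENNReal.ofReal κ₁ * ENNReal.ofReal
            |∑ i, (S.A j i : ℝ) * (w i : ℝ) - Y (-L) ω j| ∂(cpLaw lam ν (0 - -L)) ∂P := by
          refine lintegral_mono fun ω => ?_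
          rw [lintegral_const_mul' _ _ ENNReal.ofReal_ne_top, ENNReal.ofReal_mul hκ₁.le, zero_sub,
            neg_neg]
          gcongr
          have h := cpLaw_dispersion hν L hr (fun i => (S.A j i : ℝ)) hμ0 (Y (-L) ω j)
          rwa [NNReal.coe_mul, Real.coe_toNNReal _ hL0.le] at h
      _ ≤ ENNReal.ofReal (lowerBound S ℓ P D) := by
          rw [← hcond, ← hval]
          refine lintegral_mono fun ω => ?_
          simp only
          rw [← ENNReal.ofReal_mul hκ₁.le]
          refine ENNReal.ofReal_le_ofReal ?_
          refine le_trans (le_of_eq ?_) (hlp _)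
          rw [Spec.balance, hj, hℓ.longest, hD.demand_eq (by linarith : -L ≤ 0)]
          rfl
  have hlb : 0 < κ₁ * (μ * (η * √(lam * L))) := by positivity
  have := (ENNReal.ofReal_le_ofReal_iff' (p := κ₁ * (μ * (η * √(lam * L))))).1 hlower
  rcases this with h | h
  · rw [Real.sqrt_mul hlam.le] at h
    calc _ = κ₁ * (μ * (η * (√lam * √L))) := by ring
      _ ≤ _ := h
  · exact absurd h (not_le.2 hlb)

end

end

end ATO

theorem theorem3 {m n : ℕ} (S : ATO.Spec m n)
    -- order arrival rate and law of the order sizes, common to the family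
    (lam : ℝ≥0) (ν : Measure (Fin m → ℕ)) [IsProbabilityMeasure ν]
    (hmoment : ∀ i, Integrable (fun s : Fin m → ℕ => (s i : ℝ) ^ 6) ν)
    (hmean : ∀ i, 0 < (lam : ℝ) * ∫ s, (s i : ℝ) ∂ν)
    -- the family of systems, indexed by the longest lead time `L`
    {Ω : ℝ → Type*} [∀ L, MeasurableSpace (Ω L)]
    (P : ∀ L, Measure (Ω L)) [∀ L, IsProbabilityMeasure (P L)]
    (ℓ : ℝ → ℕ → ℝ) (hℓ : ∀ L > 0, ATO.IsLeadTimes S.K (ℓ L) L)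
    (D : ∀ L, ℝ → Ω L → Fin m → ℕ)
    (hD : ∀ L > 0, ATO.IsCompoundPoisson (P L) (-L) lam ν (D L))
    -- the policy that is used in each system
    (R : ∀ L, ℝ → Ω L → Fin n → ℕ) (Z : ∀ L, ℝ → Ω L → Fin m → ℕ)
    (hpol : ∀ L > 0, ATO.IsPolicy S (ℓ L) (D L) (R L) (Z L))
    -- the targets
    (Y : ∀ L, ℝ → Ω L → Fin n → ℝ)
    (hY : ∀ L > 0, ATO.IsSPSolution S (ℓ L) (P L) (D L) (Y L))
    (Bs : ∀ L, ℝ → Ω L → Fin m → ℝ)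
    (hBs : ∀ L > 0, ATO.IsIdealBacklog S (ℓ L) (P L) (D L) (Y L) (Bs L))
    -- convergence of inventory positions and of backlogs to their targets
    (hIP : ∀ j, Tendsto (fun L : ℝ => ATO.expSupDist (P L) (-(ℓ L (S.grp j) / L))
        (ATO.scaled L (ATO.invPos S (ℓ L) (D L) (R L) (Z L)))
        (ATO.scaled L (ATO.targetPos S (ℓ L) (D L) (Y L))) j) atTop (𝓝 0))
    (hB : ∀ i, Tendsto (fun L : ℝ => ATO.expSupDist (P L) 0
        (ATO.scaled L (ATO.backlog (D L) (Z L))) (ATO.scaled L (Bs L)) i) atTop (𝓝 0)) :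
    -- the average cost is finite and approaches the lower bound on the diffusion scale
    (∀ᶠ L : ℝ in atTop, ATO.avgCost S (ℓ L) (P L) (D L) (R L) (Z L) ≠ ∞) ∧
    Tendsto (fun L : ℝ => (ATO.avgCost S (ℓ L) (P L) (D L) (R L) (Z L)).toReal / √L -
        ATO.lowerBound S (ℓ L) (P L) (D L) / √L) atTop (𝓝 0) ∧
    -- the minimum cost is positive (and finite), and the relative optimality gap vanishes
    (∀ᶠ L : ℝ in atTop, 0 < ATO.minCost S (ℓ L) (P L) (D L) ∧
        ATO.minCost S (ℓ L) (P L) (D L) ≠ ∞) ∧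
    Tendsto (fun L : ℝ => ((ATO.avgCost S (ℓ L) (P L) (D L) (R L) (Z L)).toReal -
        (ATO.minCost S (ℓ L) (P L) (D L)).toReal) /
        (ATO.minCost S (ℓ L) (P L) (D L)).toReal) atTop (𝓝 0) := by
  have hK : 1 ≤ S.K := by
    by_contra h
    have h1 := hℓ 1 one_pos
    have h2 : S.K = 0 := by omega
    have h3 := h1.longest
    rw [h2, h1.zero] at h3
    exact zero_ne_one h3
  have hν : ∀ i, Integrable (fun s : Fin m → ℕ => (s i : ℝ)) ν := fun i => by
    by_contra h
    have := hmean i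
    rw [integral_undef h, mul_zero] at this
    exact lt_irrefl _ this
  obtain ⟨κ, hκ, hgrowth⟩ := ATO.exists_mul_sqrt_le_lowerBound hK hν hmean
  set lb : ℝ → ℝ := fun L => ATO.lowerBound S (ℓ L) (P L) (D L) with hlb
  set av : ℝ → ℝ≥0∞ := fun L => ATO.avgCost S (ℓ L) (P L) (D L) (R L) (Z L) with hav
  set mn : ℝ → ℝ≥0∞ := fun L => ATO.minCost S (ℓ L) (P L) (D L) with hmn
  -- weighted distances to the targets on the diffusion scale
  set ε : ℝ → ℝ≥0∞ := fun L =>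
    ∑ i, ENNReal.ofReal (S.c i) * ATO.expSupDist (P L) 0
      (ATO.scaled L (ATO.backlog (D L) (Z L))) (ATO.scaled L (Bs L)) i +
    ∑ j, ENNReal.ofReal (S.h j) * ATO.expSupDist (P L) (-(ℓ L (S.grp j) / L))
        (ATO.scaled L (ATO.invPos S (ℓ L) (D L) (R L) (Z L)))
        (ATO.scaled L (ATO.targetPos S (ℓ L) (D L) (Y L))) j with hε
  have hε0 : Tendsto ε atTop (𝓝 0) := by
    have h1 : Tendsto ε atTop (𝓝 (∑ i, ENNReal.ofReal (S.c i) * 0 +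
        ∑ j, ENNReal.ofReal (S.h j) * 0)) :=
      (tendsto_finsetSum _ fun i _ => ENNReal.Tendsto.const_mul (hB i)
        (Or.inr ENNReal.ofReal_ne_top)).add
        (tendsto_finsetSum _ fun j _ => ENNReal.Tendsto.const_mul (hIP j)
          (Or.inr ENNReal.ofReal_ne_top))
    simpa using h1
  have hlow : ∀ L > 0, ENNReal.ofReal (lb L) ≤ mn L := fun L hL =>
    le_iInf fun R' => le_iInf fun Z' => le_iInf fun hp => ATO.le_avgCost fun t ht =>
      hp.lowerBound_le_costRate hν (hℓ L hL) (hD L hL) ht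
  have hmin : ∀ L > 0, mn L ≤ av L := fun L hL => iInf_le_of_le (R L) (iInf_le_of_le (Z L)
    (iInf_le _ (hpol L hL)))
  have hup : ∀ L > 0, av L ≤ ENNReal.ofReal (lb L) + ENNReal.ofReal √L * ε L := by
    intro L hL
    refine ATO.avgCost_le fun t ht => ((hpol L hL).costRate_le hν (hℓ L hL) (hD L hL) (hY L hL)
      (hBs L hL) ht).trans ?_
    simp only [hε, mul_add, Finset.mul_sum, mul_left_comm (ENNReal.ofReal √L)]
    gcongr with i _ j _
    · exact ATO.lintegral_abs_sub_le_expSupDist hL (by positivity) i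
    · refine ATO.lintegral_abs_sub_le_expSupDist hL ?_ j
      rw [← neg_div]
      gcongr
      linarith
  have hlam : (0 : ℝ) < lam := by
    obtain ⟨j, -⟩ := S.grp_surj S.K hK le_rfl
    obtain ⟨i, -⟩ := S.row_ne_zero j
    rcases (NNReal.coe_nonneg lam).lt_or_eq with h | h
    · exact h
    · have := hmean i
      rw [← h, zero_mul] at this
      exact absurd this (lt_irrefl _)
  have hlbκ : ∀ᶠ L in atTop, κ * √L ≤ lb L := by
    filter_upwards [eventually_gt_atTop 0, eventually_ge_atTop (1 / (lam : ℝ))] with L hL hL'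
    refine hgrowth (P L) (ℓ L) L (D L) (Y L) (hℓ L hL) (hD L hL) (hY L hL) ?_
    rw [div_le_iff₀ hlam] at hL'
    linarith
  have hεfin : ∀ᶠ L in atTop, ε L ≠ ∞ :=
    (hε0.eventually (eventually_lt_nhds ENNReal.zero_lt_top)).mono fun L h => h.ne
  have havfin : ∀ᶠ L in atTop, av L ≠ ∞ := by
    filter_upwards [eventually_gt_atTop 0, hεfin] with L hL hfin
    exact ((hup L hL).trans_lt (ENNReal.add_lt_top.2 ⟨ENNReal.ofReal_lt_top,
      ENNReal.mul_lt_top ENNReal.ofReal_lt_top hfin.lt_top⟩)).ne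
  have hεreal : Tendsto (fun L => (ε L).toReal) atTop (𝓝 0) := by
    simpa only [ENNReal.toReal_zero, Function.comp_def] using
      (ENNReal.tendsto_toReal ENNReal.zero_ne_top).comp hε0
  -- the same bounds in terms of real numbers
  have hreal : ∀ᶠ L in atTop, 0 < L ∧ 0 < κ * √L ∧ κ * √L ≤ lb L ∧ lb L ≤ (mn L).toReal ∧
      (mn L).toReal ≤ (av L).toReal ∧ (av L).toReal ≤ lb L + √L * (ε L).toReal := by
    filter_upwards [eventually_gt_atTop 0, hεfin, havfin, hlbκ] with L hL hfin hafin hκL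
    have hpos : 0 < κ * √L := mul_pos hκ (Real.sqrt_pos.2 hL)
    have hlb0 : 0 ≤ lb L := hpos.le.trans hκL
    have hmfin : mn L ≠ ∞ := ne_top_of_le_ne_top hafin (hmin L hL)
    refine ⟨hL, hpos, hκL, ?_, ENNReal.toReal_mono hafin (hmin L hL), ?_⟩
    · have := ENNReal.toReal_mono hmfin (hlow L hL)
      rwa [ENNReal.toReal_ofReal hlb0] at this
    · have hne : ENNReal.ofReal √L * ε L ≠ ∞ := ENNReal.mul_ne_top ENNReal.ofReal_ne_top hfin
      have := ENNReal.toReal_mono (ENNReal.add_ne_top.2 ⟨ENNReal.ofReal_ne_top, hne⟩) (hup L hL)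
      rwa [ENNReal.toReal_add ENNReal.ofReal_ne_top hne, ENNReal.toReal_ofReal hlb0,
        ENNReal.toReal_mul, ENNReal.toReal_ofReal (Real.sqrt_nonneg L)] at this
  refine ⟨havfin, ?_, ?_, ?_⟩
  · refine squeeze_zero' (hreal.mono fun L h => ?_) (hreal.mono fun L h => ?_) hεreal
    · obtain ⟨hL, -, -, h1, h2, -⟩ := h
      rw [← sub_div]
      exact div_nonneg (by linarith) (Real.sqrt_nonneg L)
    · obtain ⟨hL, -, -, -, -, h3⟩ := h
      rw [← sub_div, div_le_iff₀ (Real.sqrt_pos.2 hL)]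
      linarith
  · filter_upwards [hreal, havfin] with L h hafin
    obtain ⟨hL, hpos, hκL, -⟩ := h
    exact ⟨(ENNReal.ofReal_pos.2 (hpos.trans_le hκL)).trans_le (hlow L hL),
      ne_top_of_le_ne_top hafin (hmin L hL)⟩
  · have hlim : Tendsto (fun L => (ε L).toReal / κ) atTop (𝓝 0) := by
      simpa using hεreal.div_const κ
    refine squeeze_zero' (hreal.mono fun L h => ?_) (hreal.mono fun L h => ?_) hlim
    · obtain ⟨-, hpos, hκL, h1, h2, -⟩ := h
      exact div_nonneg (by linarith) (by linarith)
    · obtain ⟨hL, hpos, hκL, h1, h2, h3⟩ := h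
      have hm : κ * √L ≤ (mn L).toReal := hκL.trans h1
      calc _ ≤ √L * (ε L).toReal / (κ * √L) :=
            div_le_div₀ (by positivity) (by linarith) hpos hm
        _ = _ := by
            have := (Real.sqrt_pos.2 hL).ne'
            field_simp
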